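/- Let $p$ be an odd prime and $G=(\mathbb F_p^4,+)$. For a commutative, associative, nilpotent $\mathbb F_p$-algebra structure $A=(G,+,\cdot)$ on $G$, let $x\circ y=x+y+x\cdot y$, let $\tau(x)\in\mathrm{Perm}(G)$ be the permutation $z\mapsto x\circ z$, and let $T_A=\{\tau(x):x\in G\}$, a subgroup of $\mathrm{Perm}(G)$. Let $\mathcal S$ be the set of all $T_A$ for $A$ with $\dim_{\mathbb F_p}A^2=1$ and $A^3=0$. Let $\mathrm{GL}_4(\mathbb F_p)=\mathrm{Aut}(G)\subset\mathrm{Perm}(G)$ act on subgroups of $\mathrm{Perm}(G)$ by conjugation, and for $d\in\mathbb F_p^3$ let $\mathcal O(d)$ be the orbit of $T_A$ for the algebra $A$ with $x\cdot y=(d_1x_1y_1+d_2x_2y_2+d_3x_3y_3)e_4$, where $e_1,\dots,e_4$ is the standard basis. (1) Every $T\in\mathcal S$ is a regular subgroup of $\mathrm{Perm}(G)$ contained in the holomorph $\mathrm{Hol}(G)$, the normalizer in $\mathrm{Perm}(G)$ of the group of translations. (2) Let $s,t\in\mathbb F_p$ be such that $-s$ is a nonzero square and $-t$ is a non-square. Then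 $\mathcal S$ is the disjoint union of the four orbits $\mathcal O(1,0,0)$, $\mathcal O(1,s,0)$, $\mathcal O(1,t,0)$, $\mathcal O(1,1,1)$, and their sizes are, respectively, $$(p^2+1)(p+1)(p^3-1),\quad \frac{p(p^2+1)(p^3-1)(p+1)^2}{2},\quad \frac{p(p^4-1)(p^3-1)}{2},\quad p^2(p^4-1)(p^3-1).$$ (3) Let $L/K$ be a finite Galois extension of fields with Galois group isomorphic to $G$ (that is, to $C_p^4$). A Hopf Galois structure on $L/K$ is a $K$-Hopf algebra $H$ with an action making $L$ an $H$-module algebra such that $L\otimes_K H\to\mathrm{End}_K(L)$, $a\otimes h\mapsto(b\mapsto a\,h(b))$, is bijective; two of them are identified if there is an isomorphism of Hopf algebras compatible with the actions on $L$. Then the number of Hopf Galois structures on $L/K$ is at least $|\mathcal S|$, and $|\mathcal S|>p^9$; in particular $L/K$ has more than $p^9$ Hopf Galois structures. -/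

import Mathlib

open scoped TensorProduct

universe u v

/-- A commutative, associative `F`-algebra structure (without unit) `A = (V, +, ·)` on an
`F`-vector space `V`. -/
structure CommAssocStructure (F V : Type*) [Field F] [AddCommGroup V] [Module F V] where
  /-- the multiplication of the algebra -/
  mul : V →ₗ[F] V →ₗ[F] V
  mul_comm : ∀ x y, mul x y = mul y x
  mul_assoc : ∀ x y z, mul (mul x y) z = mul x (mul y z)

/-- The powers of `A`: `A¹ = A`, and `Aᵐ⁺¹` is the span of the products of an element of `Aᵐ`
and an element of `A` (with the convention `A⁰ = A`). -/
def CommAssocStructure.pow {F V : Type*} [Field F] [AddCommGroup V] [Module F V]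
    (A : CommAssocStructure F V) : ℕ → Submodule F V
  | 0 => ⊤
  | 1 => ⊤
  | m + 2 => Submodule.map₂ A.mul (A.pow (m + 1)) ⊤

/-- A commutative, associative and nilpotent `F`-algebra structure on `V`. -/
structure NilpotentStructure (F V : Type*) [Field F] [AddCommGroup V] [Module F V] extends
    CommAssocStructure F V where
  nilpotent : ∃ m, toCommAssocStructure.pow m = ⊥

namespace NilpotentStructure

variable {F V : Type*} [Field F] [AddCommGroup V] [Module F V] (A : NilpotentStructure F V)

/-- The circle operation `x ∘ y = x + y + x · y`. -/
def circ (x y : V) : V := x + y + A.mul x y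

theorem circ_assoc (x y z : V) : A.circ (A.circ x y) z = A.circ x (A.circ y z) := by
  simp only [circ, map_add, LinearMap.add_apply, A.mul_assoc]
  abel

theorem mul_pow_mem (x z : V) (k : ℕ) : (A.mul x ^ k) z ∈ A.pow (k + 1) := by
  induction k with
  | zero => simp [CommAssocStructure.pow]
  | succ k ih =>
    rw [pow_succ', Module.End.mul_apply, A.mul_comm]
    exact Submodule.apply_mem_map₂ _ ih Submodule.mem_top

theorem isNilpotent_mul (x : V) : IsNilpotent (A.mul x : Module.End F V) := by
  obtain ⟨m, hm⟩ := A.nilpotent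
  refine ⟨m, LinearMap.ext fun z => ?_⟩
  have h := A.mul_pow_mem x z m
  cases m with
  | zero =>
    rw [show A.pow (0 + 1) = A.pow 0 from rfl, hm] at h
    simpa using h
  | succ m =>
    have h' := A.mul_pow_mem x z m
    rw [hm] at h'
    rw [pow_succ', Module.End.mul_apply, (Submodule.mem_bot F).1 h', map_zero]
    rfl

theorem circ_bijective (x : V) : Function.Bijective (A.circ x) := by
  have h := (Module.End.isUnit_iff _).1 (A.isNilpotent_mul x).isUnit_one_add
  have e : A.circ x = (Equiv.addLeft x) ∘ (1 + A.mul x : Module.End F V) := by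
    funext z
    simp [circ, add_assoc]
  rw [e]
  exact (Equiv.addLeft x).bijective.comp h

/-- The permutation `τ(x) : z ↦ x ∘ z` of `V`. -/
noncomputable def tau (x : V) : Equiv.Perm V := Equiv.ofBijective (A.circ x) (A.circ_bijective x)

theorem tau_apply (x z : V) : A.tau x z = x + z + A.mul x z := rfl

theorem tau_mul (x y : V) : A.tau x * A.tau y = A.tau (A.circ x y) :=
  Equiv.ext fun z => (A.circ_assoc x y z).symm

theorem tau_zero : A.tau 0 = 1 := Equiv.ext fun z => by simp [tau_apply]

/-- The subgroup `T = τ(V)` of `Perm V` associated to `A`. -/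
noncomputable def regularSubgroup : Subgroup (Equiv.Perm V) where
  carrier := Set.range A.tau
  mul_mem' := by
    rintro _ _ ⟨x, rfl⟩ ⟨y, rfl⟩
    exact ⟨A.circ x y, (A.tau_mul x y).symm⟩
  one_mem' := ⟨0, A.tau_zero⟩
  inv_mem' := by
    rintro _ ⟨x, rfl⟩
    obtain ⟨y, hy⟩ := (A.circ_bijective x).2 0
    refine ⟨y, (inv_eq_of_mul_eq_one_right ?_).symm⟩
    rw [A.tau_mul, hy, A.tau_zero]

/-- The bilinear product on `Fⁿ⁺¹` with structure matrix `diag(d₁, …, dₙ, 0)`: for the standard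
basis, `eᵢ · eⱼ = 0` for `i ≠ j`, `eᵢ · eᵢ = dᵢ eₙ₊₁` for `i ≤ n`, and `eₙ₊₁ · eₙ₊₁ = 0`. -/
def diagonalMul {n : ℕ} (d : Fin n → F) :
    (Fin (n + 1) → F) →ₗ[F] (Fin (n + 1) → F) →ₗ[F] (Fin (n + 1) → F) :=
  LinearMap.mk₂ F
    (fun x y => Pi.single (Fin.last n) (∑ i : Fin n, d i * x i.castSucc * y i.castSucc))
    (fun x x' y => by
      rw [← Pi.single_add, ← Finset.sum_add_distrib]
      congr 1
      exact Finset.sum_congr rfl fun i _ => by simp only [Pi.add_apply]; ring)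
    (fun c x y => by
      rw [← Pi.single_smul, Finset.smul_sum]
      congr 1
      exact Finset.sum_congr rfl fun i _ => by simp only [Pi.smul_apply, smul_eq_mul]; ring)
    (fun x y y' => by
      rw [← Pi.single_add, ← Finset.sum_add_distrib]
      congr 1
      exact Finset.sum_congr rfl fun i _ => by simp only [Pi.add_apply]; ring)
    (fun c x y => by
      rw [← Pi.single_smul, Finset.smul_sum]
      congr 1
      exact Finset.sum_congr rfl fun i _ => by simp only [Pi.smul_apply, smul_eq_mul]; ring)

theorem diagonalMul_apply {n : ℕ} (d : Fin n → F) (x y : Fin (n + 1) → F) :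
    diagonalMul d x y =
      Pi.single (Fin.last n) (∑ i : Fin n, d i * x i.castSucc * y i.castSucc) := rfl

theorem diagonalMul_diagonalMul {n : ℕ} (d : Fin n → F) (x y z : Fin (n + 1) → F) :
    diagonalMul d (diagonalMul d x y) z = 0 := by
  simp [diagonalMul_apply, Fin.castSucc_ne_last]

theorem diagonalMul_comm {n : ℕ} (d : Fin n → F) (x y : Fin (n + 1) → F) :
    diagonalMul d x y = diagonalMul d y x := by
  rw [diagonalMul_apply, diagonalMul_apply]
  congr 1
  exact Finset.sum_congr rfl fun i _ => by ring

theorem map₂_diagonalMul {n : ℕ} (d : Fin n → F) :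
    Submodule.map₂ (diagonalMul d) (Submodule.map₂ (diagonalMul d) ⊤ ⊤) ⊤ = ⊥ := by
  have h : Submodule.map₂ (diagonalMul d) ⊤ ⊤ ≤ LinearMap.ker (diagonalMul d) :=
    Submodule.map₂_le.2 fun x _ y _ =>
      LinearMap.mem_ker.2 (LinearMap.ext fun z => diagonalMul_diagonalMul d x y z)
  rw [eq_bot_iff, Submodule.map₂_le]
  intro m hm z _
  rw [LinearMap.mem_ker.1 (h hm)]
  exact Submodule.zero_mem _

/-- The algebra structure on `Fⁿ⁺¹` with structure matrix `diag(d₁, …, dₙ, 0)`. -/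
def diagonal {n : ℕ} (d : Fin n → F) : NilpotentStructure F (Fin (n + 1) → F) where
  mul := diagonalMul d
  mul_comm := diagonalMul_comm d
  mul_assoc x y z := by
    rw [diagonalMul_diagonalMul, diagonalMul_comm, diagonalMul_diagonalMul]
  nilpotent := ⟨3, map₂_diagonalMul d⟩

end NilpotentStructure

/-- A subgroup `T` of `Perm X` is regular if for all `x`, `y` there is exactly one element of `T`
that maps `x` to `y`. -/
def IsRegularSubgroup {X : Type*} (T : Subgroup (Equiv.Perm X)) : Prop :=
  ∀ x y : X, ∃! t : Equiv.Perm X, t ∈ T ∧ t x = y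

/-- The image `λ(V)` of the (left) regular representation of an additive group `V`. -/
def translations (V : Type*) [AddCommGroup V] : Subgroup (Equiv.Perm V) where
  carrier := Set.range (Equiv.addLeft : V → Equiv.Perm V)
  mul_mem' := by
    rintro _ _ ⟨x, rfl⟩ ⟨y, rfl⟩
    exact ⟨x + y, Equiv.ext fun z => by simp⟩
  one_mem' := ⟨0, Equiv.ext fun z => by simp⟩
  inv_mem' := by
    rintro _ ⟨x, rfl⟩
    exact ⟨-x, Equiv.ext fun z => by simp⟩

/-- The holomorph `Hol(V)`, the normalizer of `λ(V)` in `Perm V`. -/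
def holomorph (V : Type*) [AddCommGroup V] : Subgroup (Equiv.Perm V) :=
  Subgroup.normalizer (translations V : Set (Equiv.Perm V))

/-- The orbit of a subgroup `T` of `Perm V` under conjugation by the elements of `GL(V)`. -/
def conjOrbit (F : Type*) {V : Type*} [Field F] [AddCommGroup V] [Module F V]
    (T : Subgroup (Equiv.Perm V)) : Set (Subgroup (Equiv.Perm V)) :=
  Set.range fun P : V ≃ₗ[F] V => T.map (MulAut.conj (P.toEquiv : Equiv.Perm V)).toMonoidHom

/-- The subgroups of `Perm V` associated to the commutative nilpotent algebra structures `A` on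
`V` with `dim A² = 1` and `A³ = 0`. -/
def squareDimOneSubgroups (F V : Type*) [Field F] [AddCommGroup V] [Module F V] :
    Set (Subgroup (Equiv.Perm V)) :=
  {T | ∃ A : NilpotentStructure F V,
    Module.finrank F (A.pow 2) = 1 ∧ A.pow 3 = ⊥ ∧ A.regularSubgroup = T}

/-- The orbit, under conjugation by `GL₍ₙ₊₁₎(F)`, of the subgroup of `Perm(Fⁿ⁺¹)` associated to
the algebra with structure matrix `diag(d₁, …, dₙ, 0)`. -/
def diagonalOrbit {F : Type*} [Field F] {n : ℕ} (d : Fin n → F) :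
    Set (Subgroup (Equiv.Perm (Fin (n + 1) → F))) :=
  conjOrbit F (NilpotentStructure.diagonal d).regularSubgroup

/-- A Hopf Galois structure on a field extension `L/K`: a `K`-Hopf algebra `H` with an action on
`L` that makes `L` an `H`-module algebra, such that `L ⊗ H → End_K(L)`,
`a ⊗ h ↦ (b ↦ a · h(b))`, is bijective. -/
structure HopfGaloisStructure (K : Type u) (L : Type v) [Field K] [Field L] [Algebra K L] where
  /-- the underlying type of the Hopf algebra -/
  H : Type v
  [ring : Ring H]
  [hopf : HopfAlgebra K H]
  /-- the action of `H` on `L` -/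
  act : H →ₐ[K] Module.End K L
  /-- `h(ab) = ∑ h₍₁₎(a) h₍₂₎(b)` -/
  act_mul : ∀ (h : H) (a b : L), act h (a * b) =
    TensorProduct.lift ((LinearMap.mul K L).compl₁₂
      (act.toLinearMap.flip a) (act.toLinearMap.flip b)) (Coalgebra.comul (R := K) h)
  /-- `h(1) = ε(h)1` -/
  act_one : ∀ h : H, act h 1 = algebraMap K L (Coalgebra.counit (R := K) h)
  bijective : Function.Bijective
    (TensorProduct.lift ((LinearMap.mul K (Module.End K L)).compl₁₂
      (LinearMap.mul K L) act.toLinearMap) : L ⊗[K] H →ₗ[K] Module.End K L)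

attribute [instance] HopfGaloisStructure.ring HopfGaloisStructure.hopf

/-- Two Hopf Galois structures are identified if there is an isomorphism of Hopf algebras between
them that is compatible with the actions on `L`. -/
instance HopfGaloisStructure.setoid (K : Type u) (L : Type v) [Field K] [Field L] [Algebra K L] :
    Setoid (HopfGaloisStructure K L) where
  r S S' := ∃ f : S.H ≃ₐc[K] S'.H, ∀ h : S.H, S'.act (f h) = S.act h
  iseqv :=
    { refl := fun S => ⟨BialgEquiv.refl K S.H, fun _ => rfl⟩
      symm := by
        rintro S S' ⟨f, hf⟩
        refine ⟨f.symm, fun h => ?_⟩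
        have h1 := hf (f.symm h)
        rw [BialgEquiv.apply_symm_apply] at h1
        exact h1.symm
      trans := by
        rintro S S' S'' ⟨f, hf⟩ ⟨g, hg⟩
        exact ⟨f.trans g, fun h => (hg (f h)).trans (hf h)⟩ }

/-- The Hopf Galois structures on `L/K`, up to isomorphism. -/
def HopfGaloisClasses (K : Type u) (L : Type v) [Field K] [Field L] [Algebra K L] :
    Type (max u (v + 1)) :=
  Quotient (HopfGaloisStructure.setoid K L)

/-! The classification in (2) is a counting sandwich and needs no diagonalization of quadratic
forms. From above: if `A³ = 0` and `A²` is a line, then `A²` annihilates `A`, so the product is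
determined by the line and by a nonzero symmetric matrix of size 3. This gives at most
`(q³+q²+q+1)(q⁶-1)` subgroups (`card_squareDimOneSubgroups_le`). From below: conjugating `T_A` by
`P` gives the subgroup of the transported algebra, so an orbit has at least `|GL₄|/k` elements
whenever `k` bounds the number of automorphisms of `A`. An automorphism of a diagonal algebra is a
similitude of its form, and parametrizing these similitudes gives a suitable `k` for each of the
four forms. The orbits are disjoint because the forms differ in rank or in isotropy. The four lower
bounds add up to exactly the upper bound, so every inequality is an equality and nothing else is
left.

Statement (1) is a direct computation: commutativity of `∘` gives regularity, and `τ(x)` conjugates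
translation by `g` into translation by `g + xg`.

For (3), only an injection from the subgroups to the Hopf Galois structures is needed. Since `A³ =
0`, the additive group acts on the group `(A, ∘)` by `g • y = y - gy`, and `x ∘ (y - xy) = x + y`
makes the identity map a bijective cocycle. Such a cocycle `π : N → Gal(L/K)` turns the descended
Hopf algebra `E(N) = L[N]^Gal` into a Hopf Galois structure, with `∑ aₙ n` acting as `∑ aₙ π(n)`.
Galois descent gives `L ⊗ E(N) ≃ L[N]` and Dedekind independence of automorphisms gives bijectivity.
The same two facts recover the action, hence the product of `A`, from the isomorphism class
(`HopfGaloisStructure.smul_eq_of_ofCocycle_equiv`). -/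

/-! ### Galois descent for group algebras -/

section Descent

open MonoidAlgebra

/-- The `K`-algebra of the elements of `L[N]` that are fixed by the Galois group, where `γ` acts
by `∑ aₙ n ↦ ∑ γ(aₙ) (γ • n)`. It is written `E(N)` below. -/
noncomputable def fixedAlgebra (K : Type u) (L : Type v) [Field K] [Field L] [Algebra K L]
    (N : Type*) [Group N] [MulDistribMulAction (L ≃ₐ[K] L) N] :
    Subalgebra K (MonoidAlgebra L N) :=
  ⨅ γ : L ≃ₐ[K] L, AlgHom.equalizer
    ((mapDomainAlgHom K L (MulDistribMulAction.toMonoidHom N γ)).comp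
      (mapAlgHom N (γ : L →ₐ[K] L))) (AlgHom.id K _)

variable {K : Type u} {L : Type v} [Field K] [Field L] [Algebra K L]
  {N : Type*} [Group N] [MulDistribMulAction (L ≃ₐ[K] L) N]
  {M : Type*} [Group M] [MulDistribMulAction (L ≃ₐ[K] L) M]

/-- Elements of `E(N)` become equivariant functions `N → L`; the later identities in `E(N)` are
checked on coefficients in this form. -/
theorem mem_fixedAlgebra {f : MonoidAlgebra L N} :
    f ∈ fixedAlgebra K L N ↔ ∀ (γ : L ≃ₐ[K] L) (n : N), f.coeff (γ • n) = γ (f.coeff n) := by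
  simp only [fixedAlgebra, Algebra.mem_iInf, AlgHom.mem_equalizer]
  refine forall_congr' fun γ => ?_
  have h (n : N) : (mapDomainAlgHom K L (MulDistribMulAction.toMonoidHom N γ)
      (mapAlgHom N (γ : L →ₐ[K] L) f)).coeff (γ • n) = γ (f.coeff n) :=
    (Finsupp.mapDomain_apply (MulAction.injective γ) _ n).trans (coeff_mapAlgHom _ _ _)
  constructor
  · intro e n
    rw [← h n]
    exact congrArg (fun g : MonoidAlgebra L N => g.coeff (γ • n)) e.symm
  · intro e
    refine MonoidAlgebra.ext (Finsupp.ext fun m => ?_)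
    obtain ⟨n, rfl⟩ := MulAction.surjective γ m
    exact (h n).trans (e n).symm

theorem fixedAlgebra_coeff_smul (f : fixedAlgebra K L N) (γ : L ≃ₐ[K] L) (n : N) :
    f.1.coeff (γ • n) = γ (f.1.coeff n) := mem_fixedAlgebra.1 f.2 γ n

/-- The map `E(N) ⊗ E(M) → L[N × M]` that sends `f ⊗ g` to `(n, m) ↦ f(n) g(m)`. -/
noncomputable def fixedTensor (K : Type u) (L : Type v) [Field K] [Field L] [Algebra K L]
    (N : Type*) [Group N] [MulDistribMulAction (L ≃ₐ[K] L) N]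
    (M : Type*) [Group M] [MulDistribMulAction (L ≃ₐ[K] L) M] :
    fixedAlgebra K L N ⊗[K] fixedAlgebra K L M →ₐ[K] MonoidAlgebra L (N × M) :=
  Algebra.TensorProduct.lift
    ((mapDomainAlgHom K L (MonoidHom.inl N M)).comp (fixedAlgebra K L N).val)
    ((mapDomainAlgHom K L (MonoidHom.inr N M)).comp (fixedAlgebra K L M).val)
    fun f g => by
      have h (f : MonoidAlgebra L N) (g : MonoidAlgebra L M) :
          Commute (mapDomainAlgHom K L (MonoidHom.inl N M) f)
            (mapDomainAlgHom K L (MonoidHom.inr N M) g) := by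
        induction f using MonoidAlgebra.induction_linear with
        | zero => simp
        | add f f' hf hf' => rw [map_add]; exact hf.add_left hf'
        | single n a =>
          induction g using MonoidAlgebra.induction_linear with
          | zero => simp
          | add f f' hf hf' => rw [map_add]; exact hf.add_right hf'
          | single m b => simp [Commute, SemiconjBy, single_mul_single, mul_comm a b]
      exact h f.1 g.1

theorem fixedTensor_tmul_coeff (f : fixedAlgebra K L N) (g : fixedAlgebra K L M) (x : N × M) :
    (fixedTensor K L N M (f ⊗ₜ g)).coeff x = f.1.coeff x.1 * g.1.coeff x.2 := by
  classical
  have h (f : MonoidAlgebra L N) (g : MonoidAlgebra L M) :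
      (mapDomainAlgHom K L (MonoidHom.inl N M) f *
        mapDomainAlgHom K L (MonoidHom.inr N M) g).coeff x = f.coeff x.1 * g.coeff x.2 := by
    induction f using MonoidAlgebra.induction_linear with
    | zero => simp
    | add f f' hf hf' => rw [map_add, add_mul, coeff_add, Finsupp.add_apply, hf, hf', coeff_add,
        Finsupp.add_apply, add_mul]
    | single n a =>
      induction g using MonoidAlgebra.induction_linear with
      | zero => simp
      | add f f' hf hf' => rw [map_add, mul_add, coeff_add, Finsupp.add_apply, hf, hf', coeff_add,
          Finsupp.add_apply, mul_add]
      | single m b =>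
        obtain ⟨x, y⟩ := x
        simp [single_mul_single, Finsupp.single_apply]
        by_cases hx : n = x <;> by_cases hy : m = y <;> simp [hx, hy]
  exact h f.1 g.1

theorem fixedTensor_mem (t : fixedAlgebra K L N ⊗[K] fixedAlgebra K L M) :
    fixedTensor K L N M t ∈ fixedAlgebra K L (N × M) := by
  induction t using TensorProduct.induction_on with
  | zero => rw [map_zero]; exact zero_mem _
  | add s t hs ht => rw [map_add]; exact add_mem hs ht
  | tmul f g =>
    rw [mem_fixedAlgebra]
    rintro γ ⟨n, m⟩
    rw [fixedTensor_tmul_coeff, fixedTensor_tmul_coeff, map_mul, ← fixedAlgebra_coeff_smul,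
      ← fixedAlgebra_coeff_smul]
    rfl

variable [FiniteDimensional K L]

/-- A functional vanishing on `E(N)` vanishes on the orbit sums `∑ γ(a) (γ • n)`. As `a` varies this
is a linear relation between the automorphisms `γ`, so by Dedekind all its coefficients are zero. -/
theorem span_fixedAlgebra [Finite N] :
    Submodule.span L (fixedAlgebra K L N : Set (MonoidAlgebra L N)) = ⊤ := by
  classical
  by_contra h
  obtain ⟨ℓ, hℓ, hle⟩ := Submodule.exists_le_ker_of_lt_top _ (lt_top_iff_ne_top.2 h)
  refine hℓ (MonoidAlgebra.lhom_ext' fun n => LinearMap.ext_ring ?_)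
  have hd := Fintype.linearIndependent_iff.1 (linearIndependent_toLinearMap K L L)
  have key := hd (fun σ => ℓ (single ((algEquivEquivAlgHom K L).symm σ • n) 1)) ?_
    (algEquivEquivAlgHom K L 1)
  · rw [MulEquiv.symm_apply_apply, one_smul] at key
    simpa using key
  · refine LinearMap.ext fun a => ?_
    have hmem : ∑ γ : L ≃ₐ[K] L, single (γ • n) (γ a) ∈ fixedAlgebra K L N := by
      rw [mem_fixedAlgebra]
      intro γ m
      simp only [coeff_sum, Finsupp.finsetSum_apply, map_sum, coeff_single]
      rw [← Equiv.sum_comp (Equiv.mulLeft γ)]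
      refine Finset.sum_congr rfl fun δ _ => ?_
      simp only [Finsupp.single_apply, mul_smul, apply_ite γ, map_zero, Equiv.coe_mulLeft,
        smul_left_cancel_iff, AlgEquiv.mul_apply]
    have h0 := LinearMap.mem_ker.1 (hle (Submodule.subset_span hmem))
    rw [map_sum] at h0
    rw [LinearMap.sum_apply, ← Equiv.sum_comp (algEquivEquivAlgHom K L).toEquiv,
      LinearMap.zero_apply, ← h0]
    refine Finset.sum_congr rfl fun γ _ => ?_
    have e : (algEquivEquivAlgHom K L).symm ((algEquivEquivAlgHom K L).toEquiv γ) = γ :=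
      (algEquivEquivAlgHom K L).symm_apply_apply γ
    rw [e, ← mul_one (γ a), ← smul_eq_mul, ← smul_single, map_smul, smul_eq_mul, mul_comm]
    rfl

variable [IsGalois K L]

/-- Multiply an `L`-linear relation by `a`, apply each `γ` and use equivariance: the coefficients
become `γ(a cᵢ)`. Summing over `γ` gives a relation over `K` with coefficients `Tr(a cᵢ)`, and the
trace form is nondegenerate. -/
theorem linearIndependent_coe_fixedAlgebra {ι : Type*} {b : ι → fixedAlgebra K L N}
    (hb : LinearIndependent K b) :
    LinearIndependent L fun i => (b i : MonoidAlgebra L N) := by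
  classical
  rw [linearIndependent_iff'] at hb ⊢
  intro s c hc i hi
  have h1 (n : N) : ∑ i ∈ s, c i * (b i).1.coeff n = 0 := by
    have := congrArg (fun f : MonoidAlgebra L N => f.coeff n) hc
    simpa [coeff_sum, Finsupp.finsetSum_apply] using this
  have h2 (a : L) (n : N) (γ : L ≃ₐ[K] L) : ∑ i ∈ s, γ (a * c i) * (b i).1.coeff n = 0 := by
    have := congrArg (fun x => γ (a * x)) (h1 (γ⁻¹ • n))
    simp only [Finset.mul_sum, map_sum, mul_zero, map_zero] at this
    rw [← this]
    refine Finset.sum_congr rfl fun i _ => ?_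
    rw [← mul_assoc, map_mul _ _ (MonoidAlgebra.coeff _ _), ← fixedAlgebra_coeff_smul,
      smul_inv_smul]
  have h3 (a : L) : ∑ i ∈ s, Algebra.trace K L (a * c i) • b i = 0 := by
    refine Subtype.ext (MonoidAlgebra.ext (Finsupp.ext fun n => ?_))
    have := Finset.sum_eq_zero fun γ (_ : γ ∈ Finset.univ) => h2 a n γ
    rw [Finset.sum_comm] at this
    simp only [← Finset.sum_mul, ← trace_eq_sum_automorphisms, ← Algebra.smul_def] at this
    simpa [coeff_sum, Finsupp.finsetSum_apply] using this
  exact (traceForm_nondegenerate K L).2 (c i) fun a => hb s _ (h3 a) i hi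

/-- By the two preceding results a `K`-basis of `E(N)` is also an `L`-basis of `L[N]`. -/
theorem finrank_fixedAlgebra (K : Type u) (L : Type v) [Field K] [Field L] [Algebra K L]
    [FiniteDimensional K L] [IsGalois K L] (N : Type*) [Group N] [Finite N]
    [MulDistribMulAction (L ≃ₐ[K] L) N] :
    Module.finrank K (fixedAlgebra K L N) = Nat.card N := by
  let b := Module.Basis.ofVectorSpace K (fixedAlgebra K L N)
  have hs : ⊤ ≤ Submodule.span L (Set.range fun i => (b i : MonoidAlgebra L N)) := by
    rw [← span_fixedAlgebra (K := K), Submodule.span_le]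
    intro f hf
    have : f ∈ Submodule.span K (Set.range fun i => (b i : MonoidAlgebra L N)) := by
      have h := Submodule.mem_map_of_mem (f := (fixedAlgebra K L N).val.toLinearMap)
        (b.mem_span ⟨f, hf⟩)
      rw [Submodule.map_span, ← Set.range_comp] at h
      exact h
    exact Submodule.span_le_restrictScalars K L _ this
  let B := Module.Basis.mk (linearIndependent_coe_fixedAlgebra b.linearIndependent) hs
  rw [Module.finrank_eq_nat_card_basis b, ← Module.finrank_eq_nat_card_basis B,
    Module.finrank_eq_nat_card_basis (MonoidAlgebra.basis N L)]

instance [Finite N] : Module.Finite K (fixedAlgebra K L N) :=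
  Module.finite_of_finrank_pos (by rw [finrank_fixedAlgebra]; exact Nat.card_pos)

theorem fixedTensor_injective : Function.Injective (fixedTensor K L N M) := by
  rw [injective_iff_map_eq_zero]
  intro t ht
  let b := Module.Basis.ofVectorSpace K (fixedAlgebra K L N)
  obtain ⟨c, rfl⟩ := TensorProduct.eq_repr_basis_left b t
  have hb := linearIndependent_iff'.1 (linearIndependent_coe_fixedAlgebra b.linearIndependent)
  suffices h : ∀ i, c i = 0 by
    rw [Finsupp.ext (g := 0) h, Finsupp.sum_zero_index]
  intro i
  by_cases hi : i ∈ c.support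
  · refine Subtype.ext (MonoidAlgebra.ext (Finsupp.ext fun m => ?_))
    -- With `t = ∑ bᵢ ⊗ cᵢ`, fixing the second coordinate `m` leaves the relation `∑ cᵢ(m) bᵢ = 0`
    -- over `L`.
    refine hb c.support (fun i => (c i).1.coeff m) (MonoidAlgebra.ext (Finsupp.ext fun n => ?_)) i hi
    have h := congrArg (fun f : MonoidAlgebra L (N × M) => f.coeff (n, m)) ht
    simp only [Finsupp.sum, map_sum, coeff_sum, Finsupp.finsetSum_apply, fixedTensor_tmul_coeff]
      at h
    rw [coeff_sum, Finsupp.finsetSum_apply]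
    refine Eq.trans (Finset.sum_congr rfl fun i _ => ?_) h
    rw [coeff_smul_apply, smul_eq_mul, mul_comm]
  · simpa using hi

variable (K L N M) in
/-- The isomorphism `E(N) ⊗ E(M) ≃ E(N × M)`. -/
noncomputable def fixedTensorEquiv [Finite N] [Finite M] :
    fixedAlgebra K L N ⊗[K] fixedAlgebra K L M ≃ₐ[K] fixedAlgebra K L (N × M) :=
  AlgEquiv.ofBijective ((fixedTensor K L N M).codRestrict _ fixedTensor_mem) <| by
    have hi : Function.Injective ((fixedTensor K L N M).codRestrict _ fixedTensor_mem) :=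
      fun s t h => fixedTensor_injective (congrArg Subtype.val h)
    refine ⟨hi, ?_⟩
    have h : Module.finrank K (fixedAlgebra K L N ⊗[K] fixedAlgebra K L M) =
        Module.finrank K (fixedAlgebra K L (N × M)) := by
      rw [Module.finrank_tensorProduct, finrank_fixedAlgebra, finrank_fixedAlgebra,
        finrank_fixedAlgebra, Nat.card_prod]
    let F : fixedAlgebra K L N ⊗[K] fixedAlgebra K L M →ₗ[K] fixedAlgebra K L (N × M) :=
      ((fixedTensor K L N M).codRestrict _ fixedTensor_mem).toLinearMap
    exact (LinearMap.injective_iff_surjective_of_finrank_eq_finrank (K := K)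
      (V := fixedAlgebra K L N ⊗[K] fixedAlgebra K L M) (V₂ := fixedAlgebra K L (N × M)) h
      (f := F)).1 hi

theorem fixedTensorEquiv_coe [Finite N] [Finite M]
    (t : fixedAlgebra K L N ⊗[K] fixedAlgebra K L M) :
    (fixedTensorEquiv K L N M t : MonoidAlgebra L (N × M)) = fixedTensor K L N M t := rfl

end Descent

/-! ### The Hopf algebra structure on the fixed algebra -/

section HopfDescent

open MonoidAlgebra

section Counit

variable {K : Type u} {L : Type v} [Field K] [Field L] [Algebra K L]
  {N : Type*} [Group N] [MulDistribMulAction (L ≃ₐ[K] L) N]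

/-- The map `∑ aₙ n ↦ ∑ aₙ` on the fixed algebra. -/
noncomputable def fixedAugmentation (K : Type u) (L : Type v) [Field K] [Field L] [Algebra K L]
    (N : Type*) [Group N] [MulDistribMulAction (L ≃ₐ[K] L) N] : fixedAlgebra K L N →ₐ[K] L :=
  ((MonoidAlgebra.lift L L N 1).restrictScalars K).comp (fixedAlgebra K L N).val

theorem fixedAugmentation_apply [Fintype N] (f : fixedAlgebra K L N) :
    fixedAugmentation K L N f = ∑ n, f.1.coeff n := by
  change MonoidAlgebra.lift L L N 1 f.1 = _
  rw [MonoidAlgebra.lift_apply, Finsupp.sum_fintype _ _ (by simp)]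
  simp

variable [FiniteDimensional K L] [IsGalois K L]

/-- Applying `γ` to the sum of the coefficients only permutes them along `n ↦ γ • n`, so the sum
lies in `K`. -/
theorem fixedAugmentation_mem [Finite N] (f : fixedAlgebra K L N) :
    fixedAugmentation K L N f ∈ (⊥ : Subalgebra K L) := by
  have := Fintype.ofFinite N
  refine Algebra.mem_bot.2 ((IsGalois.mem_range_algebraMap_iff_fixed _).2 fun γ => ?_)
  rw [fixedAugmentation_apply, map_sum, ← Equiv.sum_comp (MulAction.toPerm γ) f.1.coeff]
  exact Finset.sum_congr rfl fun n _ => (fixedAlgebra_coeff_smul f γ n).symm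

/-- The counit of the fixed algebra. -/
noncomputable def fixedCounit (K : Type u) (L : Type v) [Field K] [Field L] [Algebra K L]
    (N : Type*) [Group N] [MulDistribMulAction (L ≃ₐ[K] L) N] [FiniteDimensional K L]
    [IsGalois K L] [Finite N] : fixedAlgebra K L N →ₐ[K] K :=
  (Algebra.botEquiv K L).toAlgHom.comp
    ((fixedAugmentation K L N).codRestrict ⊥ fixedAugmentation_mem)

theorem algebraMap_fixedCounit [Fintype N] (f : fixedAlgebra K L N) :
    algebraMap K L (fixedCounit K L N f) = ∑ n, f.1.coeff n := by
  rw [← fixedAugmentation_apply]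
  exact congrArg Subtype.val ((Algebra.botEquiv K L).symm_apply_apply
    ((fixedAugmentation K L N).codRestrict ⊥ fixedAugmentation_mem f))

end Counit

section Antipode

variable {K : Type u} {L : Type v} [Field K] [Field L] [Algebra K L]
  {N : Type*} [Group N] [MulDistribMulAction (L ≃ₐ[K] L) N]

/-- The antipode of the fixed algebra. -/
noncomputable def fixedAntipode (K : Type u) (L : Type v) [Field K] [Field L] [Algebra K L]
    (N : Type*) [Group N] [MulDistribMulAction (L ≃ₐ[K] L) N] :
    fixedAlgebra K L N →ₗ[K] fixedAlgebra K L N :=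
  (MonoidAlgebra.mapDomainLinearMap K L (fun n : N => n⁻¹)).restrict
    (p := (fixedAlgebra K L N).toSubmodule) (q := (fixedAlgebra K L N).toSubmodule) (by
    intro f hf
    refine mem_fixedAlgebra.2 fun γ n => ?_
    have h (m : N) : (MonoidAlgebra.mapDomainLinearMap K L (fun n : N => n⁻¹) f).coeff m⁻¹ =
      f.coeff m := Finsupp.mapDomain_apply inv_injective _ m
    rw [← inv_inv n, h, smul_inv', h, mem_fixedAlgebra.1 hf])

theorem fixedAntipode_coeff (f : fixedAlgebra K L N) (n : N) :
    (fixedAntipode K L N f).1.coeff n = f.1.coeff n⁻¹ := by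
  conv_lhs => rw [← inv_inv n]
  exact Finsupp.mapDomain_apply inv_injective _ _

end Antipode

variable {K : Type u} {L : Type v} [Field K] [Field L] [Algebra K L]
  {N : Type*} [Group N] [MulDistribMulAction (L ≃ₐ[K] L) N]

/-- The homomorphism `E(N) → E(N × N)` induced by the diagonal map `N → N × N`. -/
noncomputable def fixedDiagonal (K : Type u) (L : Type v) [Field K] [Field L] [Algebra K L]
    (N : Type*) [Group N] [MulDistribMulAction (L ≃ₐ[K] L) N] :
    fixedAlgebra K L N →ₐ[K] fixedAlgebra K L (N × N) :=
  ((mapDomainAlgHom K L ((MonoidHom.id N).prod (MonoidHom.id N))).comp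
    (fixedAlgebra K L N).val).codRestrict _ (by
    classical
    intro f
    have hi : Function.Injective ((MonoidHom.id N).prod (MonoidHom.id N)) :=
      fun _ _ h => congrArg Prod.fst h
    refine mem_fixedAlgebra.2 fun γ x => ?_
    change (Finsupp.mapDomain _ f.1.coeff) _ = γ ((Finsupp.mapDomain _ f.1.coeff) _)
    by_cases hx : x.1 = x.2
    · obtain ⟨n, m⟩ := x
      obtain rfl : n = m := hx
      exact (Finsupp.mapDomain_apply hi _ (γ • n)).trans ((fixedAlgebra_coeff_smul f γ n).trans
        (congrArg γ (Finsupp.mapDomain_apply hi _ n).symm))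
    · rw [Finsupp.mapDomain_of_notMem_range, Finsupp.mapDomain_of_notMem_range, map_zero]
      · rintro ⟨n, rfl⟩
        exact hx rfl
      · rintro ⟨n, h⟩
        exact hx (MulAction.injective γ ((congrArg Prod.fst h).symm.trans (congrArg Prod.snd h))))

theorem fixedDiagonal_coeff [DecidableEq N] (f : fixedAlgebra K L N) (x : N × N) :
    (fixedDiagonal K L N f).1.coeff x = if x.1 = x.2 then f.1.coeff x.1 else 0 := by
  have hi : Function.Injective ((MonoidHom.id N).prod (MonoidHom.id N)) :=
    fun _ _ h => congrArg Prod.fst h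
  change (Finsupp.mapDomain _ f.1.coeff) _ = _
  obtain ⟨n, m⟩ := x
  split_ifs with hx
  · obtain rfl : n = m := hx
    exact Finsupp.mapDomain_apply hi _ n
  · rw [Finsupp.mapDomain_of_notMem_range]
    rintro ⟨k, h⟩
    exact hx ((congrArg Prod.fst h).symm.trans (congrArg Prod.snd h))

/-- The pairs `(m, m n)` are those with `m⁻¹ (m n) = n`. On a comultiplication the coefficients live
on the diagonal, which these pairs meet only if `n = 1`; this is what makes the antipode axiom come
out. -/
theorem fixedAntipode_rTensor [Fintype N] (t : fixedAlgebra K L N ⊗[K] fixedAlgebra K L N)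
    (n : N) : (LinearMap.mul' K _ ((fixedAntipode K L N).rTensor
      (fixedAlgebra K L N) t)).1.coeff n = ∑ m, (fixedTensor K L N N t).coeff (m, m * n) := by
  induction t using TensorProduct.induction_on with
  | zero => simp
  | add s t hs ht =>
    simp only [map_add, coeff_add, Finsupp.add_apply, Finset.sum_add_distrib, ← hs, ← ht]
    rfl
  | tmul g h =>
    simp only [LinearMap.rTensor_tmul, LinearMap.mul'_apply, fixedTensor_tmul_coeff]
    rw [Subalgebra.coe_mul, coeff_mul_apply_left, Finsupp.sum_fintype _ _ (by simp),
      ← Equiv.sum_comp (Equiv.inv N)]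
    simp [fixedAntipode_coeff]

theorem fixedAntipode_lTensor [Fintype N] (t : fixedAlgebra K L N ⊗[K] fixedAlgebra K L N)
    (n : N) : (LinearMap.mul' K _ ((fixedAntipode K L N).lTensor
      (fixedAlgebra K L N) t)).1.coeff n = ∑ m, (fixedTensor K L N N t).coeff (m, n⁻¹ * m) := by
  induction t using TensorProduct.induction_on with
  | zero => simp
  | add s t hs ht =>
    simp only [map_add, coeff_add, Finsupp.add_apply, Finset.sum_add_distrib, ← hs, ← ht]
    rfl
  | tmul g h =>
    simp only [LinearMap.lTensor_tmul, LinearMap.mul'_apply, fixedTensor_tmul_coeff]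
    rw [Subalgebra.coe_mul, coeff_mul_apply_left, Finsupp.sum_fintype _ _ (by simp)]
    simp [fixedAntipode_coeff]

variable [FiniteDimensional K L] [IsGalois K L]

/-- The comultiplication of the fixed algebra. -/
noncomputable def fixedComul (K : Type u) (L : Type v) [Field K] [Field L] [Algebra K L]
    (N : Type*) [Group N] [MulDistribMulAction (L ≃ₐ[K] L) N] [FiniteDimensional K L]
    [IsGalois K L] [Finite N] :
    fixedAlgebra K L N →ₐ[K] fixedAlgebra K L N ⊗[K] fixedAlgebra K L N :=
  (fixedTensorEquiv K L N N).symm.toAlgHom.comp (fixedDiagonal K L N)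

/-- The comultiplication is defined through an inverse isomorphism; this formula for its image in
`L[N × N]` is the only description used afterwards. -/
theorem fixedTensor_fixedComul_coeff [Finite N] [DecidableEq N] (f : fixedAlgebra K L N)
    (x : N × N) : (fixedTensor K L N N (fixedComul K L N f)).coeff x =
      if x.1 = x.2 then f.1.coeff x.1 else 0 := by
  rw [← fixedDiagonal_coeff, ← fixedTensorEquiv_coe]
  exact congrArg (fun g : fixedAlgebra K L (N × N) => g.1.coeff x)
    ((fixedTensorEquiv K L N N).apply_symm_apply _)

/-- The isomorphism `E(N) ⊗ (E(N) ⊗ E(N)) → E(N × (N × N))`, as a map to `L[N × (N × N)]`. -/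
noncomputable def fixedTensor₃ (K : Type u) (L : Type v) [Field K] [Field L] [Algebra K L]
    (N : Type*) [Group N] [MulDistribMulAction (L ≃ₐ[K] L) N] [FiniteDimensional K L]
    [IsGalois K L] [Finite N] :
    fixedAlgebra K L N ⊗[K] (fixedAlgebra K L N ⊗[K] fixedAlgebra K L N) →ₗ[K]
      MonoidAlgebra L (N × (N × N)) :=
  (fixedTensor K L N (N × N)).toLinearMap ∘ₗ
    (fixedTensorEquiv K L N N).toLinearMap.lTensor (fixedAlgebra K L N)

theorem fixedTensor₃_injective [Finite N] : Function.Injective (fixedTensor₃ K L N) :=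
  fixedTensor_injective.comp
    (((fixedTensorEquiv K L N N).toLinearEquiv.lTensor (fixedAlgebra K L N)).injective)

theorem fixedTensor₃_tmul_coeff [Finite N] (f : fixedAlgebra K L N)
    (t : fixedAlgebra K L N ⊗[K] fixedAlgebra K L N) (x : N × (N × N)) :
    (fixedTensor₃ K L N (f ⊗ₜ t)).coeff x = f.1.coeff x.1 * (fixedTensor K L N N t).coeff x.2 :=
  fixedTensor_tmul_coeff f (fixedTensorEquiv K L N N t) x

theorem fixedTensor₃_assoc_coeff [Finite N] (t : fixedAlgebra K L N ⊗[K] fixedAlgebra K L N)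
    (f : fixedAlgebra K L N) (x : N × (N × N)) :
    (fixedTensor₃ K L N (TensorProduct.assoc K _ _ _ (t ⊗ₜ f))).coeff x =
      (fixedTensor K L N N t).coeff (x.1, x.2.1) * f.1.coeff x.2.2 := by
  induction t using TensorProduct.induction_on with
  | zero =>
    rw [TensorProduct.zero_tmul, LinearEquiv.map_zero, LinearMap.map_zero, map_zero]
    simp
  | add s t hs ht => rw [TensorProduct.add_tmul, map_add, map_add, coeff_add, Finsupp.add_apply,
      hs, ht, map_add, coeff_add, Finsupp.add_apply, add_mul]
  | tmul g h => rw [TensorProduct.assoc_tmul, fixedTensor₃_tmul_coeff, fixedTensor_tmul_coeff,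
      fixedTensor_tmul_coeff, mul_assoc]

theorem fixedTensor₃_comul_left [Finite N] [DecidableEq N]
    (t : fixedAlgebra K L N ⊗[K] fixedAlgebra K L N) (x : N × (N × N)) :
    (fixedTensor₃ K L N (TensorProduct.assoc K _ _ _
      ((fixedComul K L N).toLinearMap.rTensor (fixedAlgebra K L N) t))).coeff x =
      if x.1 = x.2.1 then (fixedTensor K L N N t).coeff (x.1, x.2.2) else 0 := by
  induction t using TensorProduct.induction_on with
  | zero =>
    rw [LinearMap.map_zero, LinearEquiv.map_zero, LinearMap.map_zero, map_zero]
    simp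
  | add s t hs ht =>
    simp only [map_add, coeff_add, Finsupp.add_apply] at hs ht ⊢
    rw [hs, ht]
    split_ifs <;> simp
  | tmul g h =>
    rw [LinearMap.rTensor_tmul, fixedTensor₃_assoc_coeff, AlgHom.toLinearMap_apply,
      fixedTensor_fixedComul_coeff, fixedTensor_tmul_coeff, ite_mul, zero_mul]

theorem fixedTensor₃_comul_right [Finite N] [DecidableEq N]
    (t : fixedAlgebra K L N ⊗[K] fixedAlgebra K L N) (x : N × (N × N)) :
    (fixedTensor₃ K L N ((fixedComul K L N).toLinearMap.lTensor (fixedAlgebra K L N) t)).coeff x =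
      if x.2.1 = x.2.2 then (fixedTensor K L N N t).coeff (x.1, x.2.1) else 0 := by
  induction t using TensorProduct.induction_on with
  | zero => simp
  | add s t hs ht =>
    simp only [map_add, coeff_add, Finsupp.add_apply] at hs ht ⊢
    rw [hs, ht]
    split_ifs <;> simp
  | tmul g h =>
    rw [LinearMap.lTensor_tmul, fixedTensor₃_tmul_coeff, AlgHom.toLinearMap_apply,
      fixedTensor_fixedComul_coeff, fixedTensor_tmul_coeff, mul_ite, mul_zero]

theorem fixedCounit_rTensor [Fintype N] (t : fixedAlgebra K L N ⊗[K] fixedAlgebra K L N) (n : N) :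
    (TensorProduct.lid K _ ((fixedCounit K L N).toLinearMap.rTensor
      (fixedAlgebra K L N) t)).1.coeff n = ∑ m, (fixedTensor K L N N t).coeff (m, n) := by
  induction t using TensorProduct.induction_on with
  | zero => simp
  | add s t hs ht =>
    simp only [map_add, coeff_add, Finsupp.add_apply, Finset.sum_add_distrib, ← hs, ← ht]
    rfl
  | tmul g h =>
    simp only [LinearMap.rTensor_tmul, TensorProduct.lid_tmul, fixedTensor_tmul_coeff,
      ← Finset.sum_mul, ← algebraMap_fixedCounit]
    rw [← Algebra.smul_def]
    rfl

theorem fixedCounit_lTensor [Fintype N] (t : fixedAlgebra K L N ⊗[K] fixedAlgebra K L N) (n : N) :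
    (TensorProduct.rid K _ ((fixedCounit K L N).toLinearMap.lTensor
      (fixedAlgebra K L N) t)).1.coeff n = ∑ m, (fixedTensor K L N N t).coeff (n, m) := by
  induction t using TensorProduct.induction_on with
  | zero => simp
  | add s t hs ht =>
    simp only [map_add, coeff_add, Finsupp.add_apply, Finset.sum_add_distrib, ← hs, ← ht]
    rfl
  | tmul g h =>
    simp only [LinearMap.lTensor_tmul, TensorProduct.rid_tmul, fixedTensor_tmul_coeff,
      ← Finset.mul_sum, ← algebraMap_fixedCounit]
    rw [mul_comm, ← Algebra.smul_def]
    rfl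

/-- Coassociativity can be tested after the injection into `L[N × (N × N)]`, where both sides are
supported on the triple diagonal. -/
noncomputable instance [Finite N] : Coalgebra K (fixedAlgebra K L N) where
  comul := (fixedComul K L N).toLinearMap
  counit := (fixedCounit K L N).toLinearMap
  coassoc := by
    classical
    refine LinearMap.ext fun f =>
      fixedTensor₃_injective (MonoidAlgebra.ext (Finsupp.ext fun x => ?_))
    obtain ⟨a, b, c⟩ := x
    refine (fixedTensor₃_comul_left _ _).trans (Eq.trans ?_ (fixedTensor₃_comul_right _ _).symm)
    simp only [AlgHom.toLinearMap_apply, fixedTensor_fixedComul_coeff]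
    by_cases h : a = b
    · subst h; simp
    · simp [h]
  rTensor_counit_comp_comul := by
    classical
    have := Fintype.ofFinite N
    refine LinearMap.ext fun f => (TensorProduct.lid K _).injective
      (Subtype.ext (MonoidAlgebra.ext (Finsupp.ext fun x => ?_)))
    refine (fixedCounit_rTensor _ _).trans ?_
    simp [fixedTensor_fixedComul_coeff]
  lTensor_counit_comp_comul := by
    classical
    have := Fintype.ofFinite N
    refine LinearMap.ext fun f => (TensorProduct.rid K _).injective
      (Subtype.ext (MonoidAlgebra.ext (Finsupp.ext fun x => ?_)))
    refine (fixedCounit_lTensor _ _).trans ?_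
    simp [fixedTensor_fixedComul_coeff]

theorem fixedAlgebra_comul_apply [Finite N] (f : fixedAlgebra K L N) :
    Coalgebra.comul (R := K) f = fixedComul K L N f := rfl

theorem fixedAlgebra_counit_apply [Finite N] (f : fixedAlgebra K L N) :
    Coalgebra.counit (R := K) f = fixedCounit K L N f := rfl

theorem algebraMap_fixedCounit_coeff [Fintype N] [DecidableEq N] (f : fixedAlgebra K L N) (n : N) :
    (algebraMap K (fixedAlgebra K L N) (fixedCounit K L N f)).1.coeff n =
      ∑ m, if n = 1 then f.1.coeff m else 0 := by
  change (algebraMap K (MonoidAlgebra L N) (fixedCounit K L N f)).coeff n = _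
  rw [MonoidAlgebra.coe_algebraMap, Function.comp_apply, algebraMap_fixedCounit, coeff_single,
    Finsupp.single_apply]
  by_cases h : n = 1
  · simp [h]
  · simp [h, Ne.symm h]

noncomputable instance [Finite N] : HopfAlgebra K (fixedAlgebra K L N) where
  __ := Bialgebra.mk' K (fixedAlgebra K L N) (map_one (fixedCounit K L N))
    (map_mul (fixedCounit K L N) _ _) (map_one (fixedComul K L N)) (map_mul (fixedComul K L N) _ _)
  antipode := fixedAntipode K L N
  mul_antipode_rTensor_comul := by
    classical
    have := Fintype.ofFinite N
    refine LinearMap.ext fun f => Subtype.ext (MonoidAlgebra.ext (Finsupp.ext fun n => ?_))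
    refine (fixedAntipode_rTensor _ _).trans ?_
    simp only [fixedAlgebra_comul_apply, fixedTensor_fixedComul_coeff, left_eq_mul]
    exact (algebraMap_fixedCounit_coeff f n).symm
  mul_antipode_lTensor_comul := by
    classical
    have := Fintype.ofFinite N
    refine LinearMap.ext fun f => Subtype.ext (MonoidAlgebra.ext (Finsupp.ext fun n => ?_))
    refine (fixedAntipode_lTensor _ _).trans ?_
    simp only [fixedAlgebra_comul_apply, fixedTensor_fixedComul_coeff, right_eq_mul, inv_eq_one]
    exact (algebraMap_fixedCounit_coeff f n).symm

end HopfDescent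

/-! ### Hopf Galois structures from bijective cocycles -/

section Cocycle

open MonoidAlgebra

variable {K : Type u} {L : Type v} [Field K] [Field L] [Algebra K L]

/-- The map `L[N] → End_K(L)`, `∑ aₙ n ↦ ∑ aₙ π(n)`, given by a map `π : N → Gal(L/K)`. -/
noncomputable def galoisEnd {N : Type*} (π : N → L ≃ₐ[K] L) :
    MonoidAlgebra L N →ₗ[L] Module.End K L :=
  Finsupp.linearCombination L (fun n => (π n : L →ₐ[K] L).toLinearMap) ∘ₗ
    (coeffLinearEquiv L).toLinearMap

theorem galoisEnd_apply {N : Type*} [Fintype N] (π : N → L ≃ₐ[K] L) (f : MonoidAlgebra L N)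
    (a : L) : galoisEnd π f a = ∑ n, f.coeff n * π n a := by
  have h : galoisEnd π f = Finsupp.linearCombination L
    (fun n => (π n : L →ₐ[K] L).toLinearMap) f.coeff := rfl
  rw [h, Finsupp.linearCombination_apply, Finsupp.sum_fintype _ _ (by simp), LinearMap.sum_apply]
  rfl

/-- Distinct automorphisms of `L` are linearly independent over `L` (Dedekind). -/
theorem galoisEnd_injective {N : Type*} {π : N → L ≃ₐ[K] L} (hπ : Function.Injective π) :
    Function.Injective (galoisEnd π) := by
  have h : LinearIndependent L fun n => (π n : L →ₐ[K] L).toLinearMap :=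
    (linearIndependent_toLinearMap K L L).comp (fun n => (π n : L →ₐ[K] L))
      (AlgEquiv.coe_toAlgHom_injective.comp hπ)
  exact Function.Injective.comp (g := Finsupp.linearCombination L _) h
    (coeffLinearEquiv L).injective

variable {N : Type*} [Group N] [MulDistribMulAction (L ≃ₐ[K] L) N]

/-- The action on `L` of the fixed algebra given by a `1`-cocycle `π : N → Gal(L/K)`. -/
noncomputable def cocycleAct [Finite N] (π : N → L ≃ₐ[K] L)
    (hπ : ∀ x y, π x * π y = π (x * π x • y)) : fixedAlgebra K L N →ₐ[K] Module.End K L :=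
  AlgHom.ofLinearMap (((galoisEnd π).restrictScalars K) ∘ₗ (fixedAlgebra K L N).val.toLinearMap)
    (by
      have := Fintype.ofFinite N
      have h1 : π 1 = 1 := by simpa using hπ 1 1
      refine LinearMap.ext fun a => (galoisEnd_apply π 1 a).trans ?_
      classical
      rw [MonoidAlgebra.one_def]
      simp [Finsupp.single_apply, h1])
    (by
      have := Fintype.ofFinite N
      intro f g
      refine LinearMap.ext fun a => (galoisEnd_apply π _ a).trans ?_
      change _ = galoisEnd π f.1 (galoisEnd π g.1 a)
      rw [galoisEnd_apply, galoisEnd_apply]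
      have hmul (n : N) : ((fixedAlgebra K L N).val.toLinearMap (f * g)).coeff n =
          ∑ x, f.1.coeff x * g.1.coeff (x⁻¹ * n) :=
        (coeff_mul_apply_left f.1 g.1 n).trans (Finsupp.sum_fintype _ _ (by simp))
      simp only [hmul, map_sum, map_mul, Finset.mul_sum, Finset.sum_mul]
      rw [Finset.sum_comm]
      refine Finset.sum_congr rfl fun x _ => ?_
      -- Substitute `n = x (π x • y)`: equivariance turns `g(π x • y)` into `π x (g y)`, and the
      -- cocycle identity splits `π n` as `π x ∘ π y`.
      rw [← Equiv.sum_comp ((MulAction.toPerm (π x)).trans (Equiv.mulLeft x))]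
      refine Finset.sum_congr rfl fun y _ => ?_
      simp [← fixedAlgebra_coeff_smul, ← hπ, mul_assoc])

theorem cocycleAct_apply [Finite N] (π : N → L ≃ₐ[K] L)
    (hπ : ∀ x y, π x * π y = π (x * π x • y)) (f : fixedAlgebra K L N) :
    cocycleAct π hπ f = galoisEnd π f.1 := rfl

theorem cocycleAct_tensor [Fintype N] (π : N → L ≃ₐ[K] L)
    (hπ : ∀ x y, π x * π y = π (x * π x • y))
    (t : fixedAlgebra K L N ⊗[K] fixedAlgebra K L N) (a b : L) :
    TensorProduct.lift ((LinearMap.mul K L).compl₁₂ ((cocycleAct π hπ).toLinearMap.flip a)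
      ((cocycleAct π hπ).toLinearMap.flip b)) t =
      ∑ x : N, ∑ y : N, (fixedTensor K L N N t).coeff (x, y) * (π x a * π y b) := by
  induction t using TensorProduct.induction_on with
  | zero => simp
  | add s t hs ht =>
    simp only [map_add, hs, ht, coeff_add, Finsupp.add_apply, Finset.sum_add_distrib, add_mul]
  | tmul g h =>
    simp only [TensorProduct.lift.tmul, LinearMap.compl₁₂_apply, LinearMap.flip_apply,
      AlgHom.toLinearMap_apply, cocycleAct_apply, galoisEnd_apply, LinearMap.mul_apply',
      fixedTensor_tmul_coeff, Finset.sum_mul_sum]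
    exact Finset.sum_congr rfl fun x _ => Finset.sum_congr rfl fun y _ => by ring

variable [FiniteDimensional K L] [IsGalois K L]

/-- The map factors as `L ⊗ E(N) → L[N] → End_K(L)`; the first arrow is injective by descent, the
second by Dedekind independence. -/
theorem cocycleAct_lift_injective [Finite N] (π : N → L ≃ₐ[K] L) (hi : Function.Injective π)
    (hπ : ∀ x y, π x * π y = π (x * π x • y)) : Function.Injective
    (TensorProduct.lift ((LinearMap.mul K (Module.End K L)).compl₁₂
      (LinearMap.mul K L) (cocycleAct π hπ).toLinearMap) :
        L ⊗[K] fixedAlgebra K L N →ₗ[K] Module.End K L) := by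
  rw [injective_iff_map_eq_zero]
  intro t ht
  let b := Module.Basis.ofVectorSpace K (fixedAlgebra K L N)
  obtain ⟨c, rfl⟩ := TensorProduct.eq_repr_basis_right b t
  have hb := linearIndependent_iff'.1 (linearIndependent_coe_fixedAlgebra b.linearIndependent)
  have h : ∑ i ∈ c.support, c i • (b i : MonoidAlgebra L N) = 0 := by
    refine galoisEnd_injective hi ?_
    rw [map_zero, map_sum, ← ht, Finsupp.sum, map_sum]
    refine Finset.sum_congr rfl fun i _ => ?_
    rw [map_smul]
    rfl
  suffices h0 : ∀ i, c i = 0 by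
    rw [Finsupp.ext (g := 0) h0, Finsupp.sum_zero_index]
  intro i
  by_cases hi : i ∈ c.support
  · exact hb c.support c h i hi
  · simpa using hi

/-- The Hopf Galois structure given by a bijective `1`-cocycle `π : N → Gal(L/K)`. -/
noncomputable def HopfGaloisStructure.ofCocycle {N : Type} [Group N]
    [MulDistribMulAction (L ≃ₐ[K] L) N] [Finite N] (π : N ≃ (L ≃ₐ[K] L))
    (hπ : ∀ x y, π x * π y = π (x * π x • y)) : HopfGaloisStructure K L where
  H := fixedAlgebra K L N
  act := cocycleAct π hπ
  act_mul := by
    classical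
    have := Fintype.ofFinite N
    intro f a b
    rw [cocycleAct_tensor, fixedAlgebra_comul_apply, cocycleAct_apply, galoisEnd_apply]
    simp [fixedTensor_fixedComul_coeff]
  act_one := by
    have := Fintype.ofFinite N
    intro f
    rw [fixedAlgebra_counit_apply, algebraMap_fixedCounit, cocycleAct_apply, galoisEnd_apply]
    simp
  bijective := by
    have hi := cocycleAct_lift_injective π π.injective hπ
    have h : Module.finrank K (L ⊗[K] fixedAlgebra K L N) =
        Module.finrank K (Module.End K L) := by
      rw [Module.finrank_tensorProduct, finrank_fixedAlgebra, Module.finrank_linearMap,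
        Nat.card_congr π, IsGalois.card_aut_eq_finrank]
    exact ⟨hi, (LinearMap.injective_iff_surjective_of_finrank_eq_finrank (K := K)
      (V := L ⊗[K] fixedAlgebra K L N) (V₂ := Module.End K L) h
      (f := TensorProduct.lift ((LinearMap.mul K (Module.End K L)).compl₁₂
      (LinearMap.mul K L) (cocycleAct π hπ).toLinearMap))).1 hi⟩

/-- If the Hopf Galois structures given by two bijective `1`-cocycles are isomorphic, then the two
actions of the Galois group agree. -/
theorem HopfGaloisStructure.smul_eq_of_ofCocycle_equiv {N N' : Type}
    [Group N] [MulDistribMulAction (L ≃ₐ[K] L) N] [Finite N]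
    [Group N'] [MulDistribMulAction (L ≃ₐ[K] L) N'] [Finite N']
    {π : N ≃ (L ≃ₐ[K] L)} {hπ : ∀ x y, π x * π y = π (x * π x • y)}
    {π' : N' ≃ (L ≃ₐ[K] L)} {hπ' : ∀ x y, π' x * π' y = π' (x * π' x • y)}
    (h : HopfGaloisStructure.ofCocycle π hπ ≈ HopfGaloisStructure.ofCocycle π' hπ')
    (γ : L ≃ₐ[K] L) (n : N) : π (γ • n) = π' (γ • π'.symm (π n)) := by
  classical
  have := Fintype.ofFinite N
  have := Fintype.ofFinite N'
  obtain ⟨e, he⟩ := h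
  -- An endomorphism `∑ aₙ π(n)` determines its coefficients, so an isomorphism compatible with the
  -- actions can only relabel coefficients along `π'⁻¹ π`.
  have key (f : fixedAlgebra K L N) (m : N) :
      f.1.coeff m = (e f : fixedAlgebra K L N').1.coeff (π'.symm (π m)) := by
    have h1 : galoisEnd π' (e f : fixedAlgebra K L N').1 = galoisEnd π f.1 := he f
    have h2 : galoisEnd π (MonoidAlgebra.mapDomain (π'.trans π.symm)
        (e f : fixedAlgebra K L N').1) = galoisEnd π f.1 := by
      rw [← h1]
      refine LinearMap.ext fun a => ?_
      rw [galoisEnd_apply, galoisEnd_apply, ← Equiv.sum_comp (π'.trans π.symm)]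
      refine Finset.sum_congr rfl fun n _ => ?_
      congr 1
      · exact Finsupp.mapDomain_apply (Equiv.injective _) _ _
      · simp
    rw [← galoisEnd_injective π.injective h2]
    have h3 : m = (π'.trans π.symm) (π'.symm (π m)) := by simp
    conv_lhs => rw [h3]
    exact Finsupp.mapDomain_apply (Equiv.injective _) _ _
  -- Since `E(N)` spans `L[N]` over `L`, its members separate the points of `N`.
  have sep (m m' : N) (hm : ∀ f : fixedAlgebra K L N, f.1.coeff m = f.1.coeff m') : m = m' := by
    have hle : Submodule.span L (fixedAlgebra K L N : Set (MonoidAlgebra L N)) ≤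
        LinearMap.ker ((Finsupp.lapply m - Finsupp.lapply m') ∘ₗ
          (coeffLinearEquiv L : MonoidAlgebra L N ≃ₗ[L] N →₀ L).toLinearMap) := by
      rw [Submodule.span_le]
      intro f hf
      exact sub_eq_zero.2 (hm ⟨f, hf⟩)
    rw [span_fixedAlgebra] at hle
    have h4 : (single m (1 : L)).coeff m - (single m (1 : L)).coeff m' = 0 :=
      hle (Submodule.mem_top (x := single m (1 : L)))
    by_contra hne
    simp [hne] at h4
  have hs : γ • n = π.symm (π' (γ • π'.symm (π n))) := by
    refine sep _ _ fun f => ?_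
    rw [fixedAlgebra_coeff_smul, key f n, key f (π.symm _), Equiv.apply_symm_apply,
      Equiv.symm_apply_apply]
    exact (fixedAlgebra_coeff_smul (N := N') _ _ _).symm
  rw [hs, Equiv.apply_symm_apply]

end Cocycle

/-! ### Regular subgroups of the holomorph -/

namespace NilpotentStructure

variable {F V : Type*} [Field F] [AddCommGroup V] [Module F V]

theorem pow_two_eq (A : NilpotentStructure F V) :
    A.pow 2 = Submodule.map₂ A.mul ⊤ ⊤ := rfl

theorem pow_three_eq (A : NilpotentStructure F V) :
    A.pow 3 = Submodule.map₂ A.mul (A.pow 2) ⊤ := rfl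

theorem mul_mem_pow_two (A : NilpotentStructure F V) (x y : V) : A.mul x y ∈ A.pow 2 :=
  Submodule.apply_mem_map₂ _ Submodule.mem_top Submodule.mem_top

theorem mul_eq_zero_of_mem_pow_two {A : NilpotentStructure F V} (h : A.pow 3 = ⊥) {v : V}
    (hv : v ∈ A.pow 2) (z : V) : A.mul v z = 0 := by
  have := Submodule.apply_mem_map₂ A.mul hv (Submodule.mem_top (x := z))
  rwa [← pow_three_eq, h, Submodule.mem_bot] at this

theorem mul_mul_eq_zero {A : NilpotentStructure F V} (h : A.pow 3 = ⊥) (x y z : V) :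
    A.mul (A.mul x y) z = 0 :=
  mul_eq_zero_of_mem_pow_two h (A.mul_mem_pow_two x y) z

theorem mul_mul_eq_zero' {A : NilpotentStructure F V} (h : A.pow 3 = ⊥) (x y z : V) :
    A.mul x (A.mul y z) = 0 := by
  rw [A.mul_comm, mul_mul_eq_zero h]

theorem tau_apply_zero (A : NilpotentStructure F V) (x : V) : A.tau x 0 = x := by
  simp [tau_apply]

/-- The element of the subgroup sending `0` to `x` is `τ(x)`, so the subgroup determines `τ` and
with it the product. -/
theorem regularSubgroup_eq_iff {A B : NilpotentStructure F V} :
    A.regularSubgroup = B.regularSubgroup ↔ A.mul = B.mul := by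
  constructor
  · intro h
    refine LinearMap.ext fun x => LinearMap.ext fun z => ?_
    have hx : A.tau x ∈ A.regularSubgroup := ⟨x, rfl⟩
    rw [h] at hx
    obtain ⟨y, hy⟩ := hx
    have h0 := congrArg (fun t : Equiv.Perm V => t 0) hy
    simp only [tau_apply_zero] at h0
    have hz := congrArg (fun t : Equiv.Perm V => t z) hy
    simp only [tau_apply, h0] at hz
    exact (add_left_cancel hz).symm
  · intro h
    have ht (x : V) : A.tau x = B.tau x := Equiv.ext fun z => by simp [tau_apply, h]
    have hr : Set.range A.tau = Set.range B.tau := congrArg Set.range (funext ht)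
    exact SetLike.coe_injective hr

theorem isRegularSubgroup (A : NilpotentStructure F V) : IsRegularSubgroup A.regularSubgroup := by
  intro x y
  obtain ⟨c, hc⟩ := (A.circ_bijective x).2 y
  refine ⟨A.tau c, ⟨⟨c, rfl⟩, ?_⟩, ?_⟩
  · rw [← hc, tau_apply, circ, A.mul_comm, add_comm c x]
  · rintro _ ⟨⟨d, rfl⟩, hd⟩
    congr 1
    refine (A.circ_bijective x).1 ?_
    rw [hc, ← hd, tau_apply, circ, A.mul_comm, add_comm d x]

theorem tau_conj_translation (A : NilpotentStructure F V) (x g : V) :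
    A.tau x * Equiv.addLeft g * (A.tau x)⁻¹ = Equiv.addLeft (g + A.mul x g) := by
  rw [mul_inv_eq_iff_eq_mul]
  refine Equiv.ext fun z => ?_
  simp only [Equiv.Perm.mul_apply, Equiv.coe_addLeft, tau_apply, map_add]
  abel

theorem regularSubgroup_le_holomorph (A : NilpotentStructure F V) :
    A.regularSubgroup ≤ holomorph V := by
  have key : ∀ t ∈ A.regularSubgroup, ∀ l ∈ translations V, t * l * t⁻¹ ∈ translations V := by
    rintro _ ⟨x, rfl⟩ _ ⟨g, rfl⟩
    exact ⟨_, (A.tau_conj_translation x g).symm⟩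
  intro t ht
  refine Subgroup.mem_normalizer_iff.2 fun l => ⟨key t ht l, fun h => ?_⟩
  have := key t⁻¹ (inv_mem ht) _ h
  simpa [mul_assoc] using this

end NilpotentStructure

/-! ### The circle group as a source of bijective cocycles -/

/-- The underlying space of a commutative nilpotent algebra, seen as a group under the circle
operation. -/
def CircleGroup {F V : Type*} [Field F] [AddCommGroup V] [Module F V]
    (_ : NilpotentStructure F V) : Type _ := V

namespace CircleGroup

variable {F V : Type*} [Field F] [AddCommGroup V] [Module F V]

/-- The identity map from the algebra to its circle group. -/
def equiv (A : NilpotentStructure F V) : V ≃ CircleGroup A := Equiv.refl V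

variable {A : NilpotentStructure F V}

noncomputable instance : Group (CircleGroup A) where
  mul x y := equiv A (A.circ ((equiv A).symm x) ((equiv A).symm y))
  one := equiv A 0
  inv x := equiv A ((A.tau ((equiv A).symm x)).symm 0)
  mul_assoc x y z := A.circ_assoc x y z
  one_mul x := by
    change A.circ 0 ((equiv A).symm x) = (equiv A).symm x
    simp [NilpotentStructure.circ]
  mul_one x := by
    change A.circ ((equiv A).symm x) 0 = (equiv A).symm x
    simp [NilpotentStructure.circ]
  inv_mul_cancel x := by
    have h : A.circ ((equiv A).symm x) ((A.tau ((equiv A).symm x)).symm 0) = 0 :=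
      (A.tau ((equiv A).symm x)).apply_symm_apply 0
    change A.circ ((A.tau ((equiv A).symm x)).symm 0) ((equiv A).symm x) = 0
    refine Eq.trans ?_ h
    rw [NilpotentStructure.circ, NilpotentStructure.circ, A.mul_comm]
    abel

/-- The action of a group isomorphic to the additive group of `A` on the circle group of `A`,
that corresponds to conjugation of the regular subgroup of `A` by translations. -/
@[reducible]
def action (h : A.pow 3 = ⊥) {G : Type*} [Group G] (e : G ≃* Multiplicative V) :
    MulDistribMulAction G (CircleGroup A) where
  -- Conjugating `τ(y)` by translation by `g` gives `τ(y - gy)` because `A³ = 0`. Products of three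
  -- elements vanish, so `(1 - g)(1 - g')` acts as `1 - (g + g')` and the action respects `∘`.
  smul g y := equiv A ((equiv A).symm y - A.mul (e g).toAdd ((equiv A).symm y))
  one_smul y := by
    change equiv A ((equiv A).symm y - A.mul (e 1).toAdd ((equiv A).symm y)) = y
    simp
  mul_smul g g' y := by
    change equiv A ((equiv A).symm y - A.mul (e (g * g')).toAdd ((equiv A).symm y)) =
      equiv A (((equiv A).symm y - A.mul (e g').toAdd ((equiv A).symm y)) - A.mul (e g).toAdd
        ((equiv A).symm y - A.mul (e g').toAdd ((equiv A).symm y)))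
    congr 1
    simp only [map_mul, toAdd_mul, map_add, map_sub, LinearMap.add_apply,
      NilpotentStructure.mul_mul_eq_zero' h]
    abel
  smul_one g := by
    change equiv A ((0 : V) - A.mul (e g).toAdd (0 : V)) = equiv A 0
    simp
  smul_mul g x y := by
    change equiv A (A.circ ((equiv A).symm x) ((equiv A).symm y) - A.mul (e g).toAdd
        (A.circ ((equiv A).symm x) ((equiv A).symm y))) =
      equiv A (A.circ ((equiv A).symm x - A.mul (e g).toAdd ((equiv A).symm x))
        ((equiv A).symm y - A.mul (e g).toAdd ((equiv A).symm y)))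
    congr 1
    simp only [NilpotentStructure.circ, map_add, map_sub, LinearMap.sub_apply,
      NilpotentStructure.mul_mul_eq_zero' h, NilpotentStructure.mul_mul_eq_zero h]
    abel

end CircleGroup

section HopfGalois

variable {K : Type u} {L : Type v} [Field K] [Field L] [Algebra K L]
  [FiniteDimensional K L] [IsGalois K L]
  {F V : Type} [Field F] [AddCommGroup V] [Module F V] [Finite V]

/-- The Hopf Galois structure given by a commutative nilpotent algebra `A` with `A³ = 0` whose
additive group is the Galois group. -/
noncomputable def HopfGaloisStructure.ofNilpotent (A : NilpotentStructure F V) (h : A.pow 3 = ⊥)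
    (e : (L ≃ₐ[K] L) ≃* Multiplicative V) : HopfGaloisStructure K L :=
  letI := CircleGroup.action h e
  haveI : Finite (CircleGroup A) := ‹Finite V›
  HopfGaloisStructure.ofCocycle
    (((CircleGroup.equiv A).symm.trans Multiplicative.ofAdd).trans e.symm.toEquiv) (by
      intro x y
      refine (e.symm.map_mul _ _).symm.trans (congrArg e.symm ?_)
      -- The cocycle identity reduces to `x ∘ (y - xy) = x + y`, where the term `x(xy)` is zero.
      change Multiplicative.ofAdd ((CircleGroup.equiv A).symm x + (CircleGroup.equiv A).symm y) =
        Multiplicative.ofAdd (A.circ ((CircleGroup.equiv A).symm x)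
          ((CircleGroup.equiv A).symm y -
            A.mul (e (e.symm (Multiplicative.ofAdd ((CircleGroup.equiv A).symm x)))).toAdd
              ((CircleGroup.equiv A).symm y)))
      rw [MulEquiv.apply_symm_apply, NilpotentStructure.circ, map_sub,
        NilpotentStructure.mul_mul_eq_zero' h, toAdd_ofAdd]
      congr 1
      abel)

/-- The two cocycles are the same identity map, so isomorphic structures have equal actions `y -
xy`, hence equal products. -/
theorem HopfGaloisStructure.mul_eq_of_ofNilpotent_equiv {A B : NilpotentStructure F V}
    {hA : A.pow 3 = ⊥} {hB : B.pow 3 = ⊥} {e : (L ≃ₐ[K] L) ≃* Multiplicative V}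
    (h : HopfGaloisStructure.ofNilpotent A hA e ≈ HopfGaloisStructure.ofNilpotent B hB e) :
    A.mul = B.mul := by
  let := CircleGroup.action hA e
  let := CircleGroup.action hB e
  have : Finite (CircleGroup A) := ‹Finite V›
  have : Finite (CircleGroup B) := ‹Finite V›
  refine LinearMap.ext fun x => LinearMap.ext fun y => ?_
  have key := HopfGaloisStructure.smul_eq_of_ofCocycle_equiv h
    (e.symm (Multiplicative.ofAdd x)) (CircleGroup.equiv A y)
  have key2 : y - A.mul (e (e.symm (Multiplicative.ofAdd x))).toAdd y =
      (e (e.symm (Multiplicative.ofAdd y))).toAdd -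
        B.mul (e (e.symm (Multiplicative.ofAdd x))).toAdd
          (e (e.symm (Multiplicative.ofAdd y))).toAdd := e.symm.injective key
  simpa using key2

theorem encard_squareDimOneSubgroups_le (e : (L ≃ₐ[K] L) ≃* Multiplicative V) :
    (squareDimOneSubgroups F V).encard ≤ ENat.card (HopfGaloisClasses K L) := by
  choose A _ hA hT using fun T : squareDimOneSubgroups F V => T.2
  refine ENat.card_le_card_of_injective
    (f := fun T : squareDimOneSubgroups F V =>
      (Quotient.mk _ (HopfGaloisStructure.ofNilpotent (A T) (hA T) e) : HopfGaloisClasses K L)) ?_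
  intro T T' h
  refine Subtype.ext ?_
  rw [← hT T, ← hT T', NilpotentStructure.regularSubgroup_eq_iff]
  exact HopfGaloisStructure.mul_eq_of_ofNilpotent_equiv (Quotient.exact h)

end HopfGalois

/-! ### Conjugation orbits and transport of structure -/

namespace NilpotentStructure

variable {F V : Type*} [Field F] [AddCommGroup V] [Module F V]

/-- Transport of the multiplication of an algebra along a linear automorphism. -/
def transportMul (A : NilpotentStructure F V) (P : V ≃ₗ[F] V) : V →ₗ[F] V →ₗ[F] V :=
  (A.mul.compl₁₂ P.symm.toLinearMap P.symm.toLinearMap).compr₂ P.toLinearMap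

theorem transportMul_apply (A : NilpotentStructure F V) (P : V ≃ₗ[F] V) (x y : V) :
    A.transportMul P x y = P (A.mul (P.symm x) (P.symm y)) := rfl

theorem transportMul_map (A : NilpotentStructure F V) (P : V ≃ₗ[F] V) (x y : V) :
    A.transportMul P (P x) (P y) = P (A.mul x y) := by
  simp [transportMul_apply]

/-- Transport of an algebra structure along a linear automorphism. -/
def transportCommAssoc (A : NilpotentStructure F V) (P : V ≃ₗ[F] V) : CommAssocStructure F V where
  mul := A.transportMul P
  mul_comm x y := by rw [transportMul_apply, transportMul_apply, A.mul_comm]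
  mul_assoc x y z := by simp [transportMul_apply, A.mul_assoc]

theorem transportCommAssoc_pow (A : NilpotentStructure F V) (P : V ≃ₗ[F] V) (m : ℕ) :
    (A.transportCommAssoc P).pow m = (A.pow m).map P.toLinearMap := by
  induction m using Nat.twoStepInduction with
  | zero =>
    change (⊤ : Submodule F V) = Submodule.map P.toLinearMap ⊤
    rw [Submodule.map_top, LinearEquiv.range]
  | one =>
    change (⊤ : Submodule F V) = Submodule.map P.toLinearMap ⊤
    rw [Submodule.map_top, LinearEquiv.range]
  | more n _ ih =>
    change Submodule.map₂ (A.transportMul P) ((A.transportCommAssoc P).pow (n + 1)) ⊤ =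
      (Submodule.map₂ A.mul (A.pow (n + 1)) ⊤).map P.toLinearMap
    rw [ih, Submodule.map_map₂]
    refine le_antisymm (Submodule.map₂_le.2 ?_) (Submodule.map₂_le.2 ?_)
    · rintro _ ⟨x, hx, rfl⟩ y _
      have := Submodule.apply_mem_map₂ (A.mul.compr₂ P.toLinearMap) hx
        (Submodule.mem_top (x := P.symm y))
      simpa [transportMul_apply] using this
    · intro x hx y _
      have := Submodule.apply_mem_map₂ (A.transportMul P) (Submodule.mem_map_of_mem
        (f := P.toLinearMap) hx) (Submodule.mem_top (x := P y))
      simpa [transportMul_apply] using this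

/-- Transport of a nilpotent algebra structure along a linear automorphism. -/
def transport (A : NilpotentStructure F V) (P : V ≃ₗ[F] V) : NilpotentStructure F V where
  toCommAssocStructure := A.transportCommAssoc P
  nilpotent := by
    obtain ⟨m, hm⟩ := A.nilpotent
    exact ⟨m, by rw [transportCommAssoc_pow, hm, Submodule.map_bot]⟩

theorem transport_mul (A : NilpotentStructure F V) (P : V ≃ₗ[F] V) :
    (A.transport P).mul = A.transportMul P := rfl

theorem transport_pow (A : NilpotentStructure F V) (P : V ≃ₗ[F] V) (m : ℕ) :
    (A.transport P).pow m = (A.pow m).map P.toLinearMap := A.transportCommAssoc_pow P m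

theorem transport_tau (A : NilpotentStructure F V) (P : V ≃ₗ[F] V) (x : V) :
    (P.toEquiv : Equiv.Perm V) * A.tau x * (P.toEquiv : Equiv.Perm V)⁻¹ =
      (A.transport P).tau (P x) := by
  rw [mul_inv_eq_iff_eq_mul]
  refine Equiv.ext fun z => ?_
  change P (A.tau x z) = (A.transport P).tau (P x) (P z)
  rw [tau_apply, tau_apply, transport_mul, transportMul_map, map_add, map_add]

theorem map_conj_regularSubgroup (A : NilpotentStructure F V) (P : V ≃ₗ[F] V) :
    A.regularSubgroup.map (MulAut.conj (P.toEquiv : Equiv.Perm V)).toMonoidHom =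
      (A.transport P).regularSubgroup := by
  ext t
  constructor
  · rintro ⟨_, ⟨x, rfl⟩, rfl⟩
    exact ⟨P x, (A.transport_tau P x).symm⟩
  · rintro ⟨x, rfl⟩
    refine ⟨A.tau (P.symm x), ⟨_, rfl⟩, (A.transport_tau P _).trans ?_⟩
    rw [P.apply_symm_apply]

theorem conjOrbit_eq (A : NilpotentStructure F V) :
    conjOrbit F A.regularSubgroup = Set.range fun P => (A.transport P).regularSubgroup :=
  congrArg Set.range (funext fun P => A.map_conj_regularSubgroup P)

/-- The linear automorphisms that preserve the multiplication of an algebra. -/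
def automorphisms (A : NilpotentStructure F V) : Set (V ≃ₗ[F] V) :=
  {R | ∀ x y, R (A.mul x y) = A.mul (R x) (R y)}

theorem transport_eq_iff {A B : NilpotentStructure F V} {P Q : V ≃ₗ[F] V} :
    (A.transport P).regularSubgroup = (B.transport Q).regularSubgroup ↔
      ∀ x y, (P.trans Q.symm) (A.mul x y) = B.mul ((P.trans Q.symm) x) ((P.trans Q.symm) y) := by
  rw [regularSubgroup_eq_iff, transport_mul, transport_mul]
  constructor
  · intro h x y
    have := congrArg (fun m : V →ₗ[F] V →ₗ[F] V => Q.symm (m (P x) (P y))) h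
    simpa [transportMul_apply] using this
  · intro h
    refine LinearMap.ext fun x => LinearMap.ext fun y => Q.symm.injective ?_
    simpa [transportMul_apply] using h (P.symm x) (P.symm y)

/-- One half of orbit–stabilizer: the fibre of `P ↦ P T P⁻¹` through `Q` embeds in the automorphisms
of `A` by `P ↦ Q⁻¹P`. -/
theorem card_linearEquiv_le [Finite V] (A : NilpotentStructure F V) :
    Nat.card (V ≃ₗ[F] V) ≤ A.automorphisms.ncard * (conjOrbit F A.regularSubgroup).ncard := by
  classical
  have : Finite (V ≃ₗ[F] V) := Finite.of_injective (fun P => (P : V → V)) DFunLike.coe_injective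
  have := Fintype.ofFinite (V ≃ₗ[F] V)
  let f : (V ≃ₗ[F] V) → Subgroup (Equiv.Perm V) := fun P => (A.transport P).regularSubgroup
  have h : (conjOrbit F A.regularSubgroup).ncard = (Finset.univ.image f).card := by
    rw [← Set.ncard_coe_finset, conjOrbit_eq]
    congr 1
    simp [f]
  rw [h, Nat.card_eq_fintype_card, ← Finset.card_univ]
  refine Finset.card_le_mul_card_image _ _ fun T hT => ?_
  obtain ⟨Q, -, rfl⟩ := Finset.mem_image.1 hT
  rw [← Set.ncard_coe_finset]
  refine Set.ncard_le_ncard_of_injOn (fun P => P.trans Q.symm) ?_ ?_ (Set.toFinite _)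
  · intro P hP
    have : f P = f Q := by simpa using hP
    exact transport_eq_iff.1 this
  · intro P _ P' _ h
    refine LinearEquiv.ext fun x => Q.symm.injective ?_
    exact LinearEquiv.congr_fun h x

theorem disjoint_conjOrbit {A B : NilpotentStructure F V}
    (h : ∀ R : V ≃ₗ[F] V, ¬ ∀ x y, R (A.mul x y) = B.mul (R x) (R y)) :
    Disjoint (conjOrbit F A.regularSubgroup) (conjOrbit F B.regularSubgroup) := by
  rw [conjOrbit_eq, conjOrbit_eq, Set.disjoint_left]
  rintro _ ⟨P, rfl⟩ ⟨Q, hQ⟩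
  exact h _ (transport_eq_iff.1 hQ.symm)

theorem conjOrbit_eq_of_map {A B : NilpotentStructure F V} (R : V ≃ₗ[F] V)
    (h : ∀ x y, R (A.mul x y) = B.mul (R x) (R y)) :
    conjOrbit F A.regularSubgroup = conjOrbit F B.regularSubgroup := by
  rw [conjOrbit_eq, conjOrbit_eq]
  ext T
  constructor
  · rintro ⟨P, rfl⟩
    refine ⟨R.symm.trans P, (transport_eq_iff.2 ?_).symm⟩
    convert h using 3 <;> simp
  · rintro ⟨P, rfl⟩
    refine ⟨R.trans P, transport_eq_iff.2 ?_⟩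
    convert h using 3 <;> simp

theorem conjOrbit_subset {A : NilpotentStructure F V} (h2 : Module.finrank F (A.pow 2) = 1)
    (h3 : A.pow 3 = ⊥) : conjOrbit F A.regularSubgroup ⊆ squareDimOneSubgroups F V := by
  rw [conjOrbit_eq]
  rintro _ ⟨P, rfl⟩
  refine ⟨A.transport P, ?_, ?_, rfl⟩
  · rw [transport_pow]
    exact (LinearEquiv.finrank_map_eq P _).trans h2
  · rw [transport_pow, h3, Submodule.map_bot]

end NilpotentStructure

/-! ### Upper bound for the number of subgroups -/

section UpperBound

open Module

variable {F V : Type*} [Field F] [AddCommGroup V] [Module F V]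

theorem exists_insert_span_eq_top [FiniteDimensional F V] {n : ℕ} (hn : finrank F V = n + 1)
    {v : V} (hv : v ≠ 0) :
    ∃ b : Fin n → V, Submodule.span F (insert v (Set.range b)) = ⊤ := by
  obtain ⟨W, hW⟩ := Submodule.exists_isCompl (Submodule.span F {v})
  have hd := Submodule.finrank_add_eq_of_isCompl hW
  rw [finrank_span_singleton hv, hn, add_comm, add_left_inj] at hd
  refine ⟨fun i => (finBasisOfFinrankEq F W hd i : V), ?_⟩
  rw [Submodule.span_insert, ← hW.sup_eq_top]
  congr 1
  have := congrArg (Submodule.map W.subtype) (finBasisOfFinrankEq F W hd).span_eq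
  rwa [Submodule.map_span, ← Set.range_comp, Submodule.map_top, Submodule.range_subtype] at this

theorem NilpotentStructure.exists_pow_two_eq_submodule {A : NilpotentStructure F V}
    (h : finrank F (A.pow 2) = 1) :
    ∃ q : Projectivization F V, A.pow 2 = q.submodule :=
  ⟨Projectivization.mk'' (A.pow 2) h, (Projectivization.submodule_mk'' _ h).symm⟩

/-- The line `A²` annihilates `A`, so once it is fixed the product amounts to a nonzero symmetric
form on a complement of dimension `n`, with `(n + 1).choose 2` free entries. -/
theorem card_squareDimOneSubgroups_le [Finite F] [FiniteDimensional F V] {n : ℕ}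
    (hn : finrank F V = n + 1) :
    (squareDimOneSubgroups F V).ncard ≤
      (∑ i ∈ Finset.range (n + 1), Nat.card F ^ i) * (Nat.card F ^ (n + 1).choose 2 - 1) := by
  classical
  have := Fintype.ofFinite F
  have : Finite V := Module.finite_of_finite F
  have hφ (q : Projectivization F V) : ∃ φ : Dual F V, φ q.rep = 1 :=
    Projective.exists_dual_eq_one F q.rep_nonzero
  -- The functional and the complementary vectors are chosen for each line and not for each algebra,
  -- so that entries of algebras with the same square can be compared.
  choose φ hφ using hφ
  choose b hb using fun q : Projectivization F V => exists_insert_span_eq_top hn q.rep_nonzero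
  choose A hA2 hA3 hT using fun T : squareDimOneSubgroups F V => T.2
  choose q hq using fun T => NilpotentStructure.exists_pow_two_eq_submodule (hA2 T)
  have hmul (T) (x y : V) : φ (q T) ((A T).mul x y) • (q T).rep = (A T).mul x y := by
    have h := (A T).mul_mem_pow_two x y
    rw [hq, Projectivization.submodule_eq, Submodule.mem_span_singleton] at h
    obtain ⟨c, hc⟩ := h
    rw [← hc, map_smul, hφ, smul_eq_mul, mul_one]
  have hrep (T) (x : V) : (A T).mul (q T).rep x = 0 := by
    refine NilpotentStructure.mul_eq_zero_of_mem_pow_two (hA3 T) ?_ x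
    rw [hq, Projectivization.submodule_eq]
    exact Submodule.mem_span_singleton_self _
  have hrep' (T) (x : V) : (A T).mul x (q T).rep = 0 := by rw [(A T).mul_comm, hrep]
  let g (T : squareDimOneSubgroups F V) : Sym2 (Fin n) → F :=
    Sym2.lift ⟨fun i j => φ (q T) ((A T).mul (b (q T) i) (b (q T) j)),
      fun i j => congrArg (φ (q T)) ((A T).mul_comm _ _)⟩
  have hext {T} {m : V →ₗ[F] V →ₗ[F] V} (h : ∀ i j, (A T).mul (b (q T) i) (b (q T) j) =
      m (b (q T) i) (b (q T) j)) (h1 : ∀ x, m (q T).rep x = 0) (h2 : ∀ x, m x (q T).rep = 0) :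
      (A T).mul = m := by
    refine LinearMap.ext_on (hb (q T)) ?_
    rintro x (rfl | ⟨i, rfl⟩)
    · exact LinearMap.ext fun y => by rw [hrep, h1]
    · refine LinearMap.ext_on (hb (q T)) ?_
      rintro x (rfl | ⟨j, rfl⟩)
      · rw [hrep', h2]
      · exact h i j
  -- A zero matrix would give `A² = 0`, against dimension one; this removes one matrix per line.
  have hg0 (T) : g T ≠ 0 := by
    intro h0
    have hm : (A T).mul = 0 := by
      refine hext (fun i j => ?_) (fun _ => rfl) (fun _ => rfl)
      rw [← hmul, show φ (q T) ((A T).mul (b (q T) i) (b (q T) j)) = 0 from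
        congrFun h0 s(i, j), zero_smul]
      rfl
    have h2 := hA2 T
    rw [NilpotentStructure.pow_two_eq, hm, show Submodule.map₂ (0 : V →ₗ[F] V →ₗ[F] V) ⊤ ⊤ = ⊥ from
      le_bot_iff.1 (Submodule.map₂_le.2 fun _ _ _ _ => rfl), finrank_bot] at h2
    exact zero_ne_one h2
  have hinj : Function.Injective fun T =>
      (q T, (⟨g T, hg0 T⟩ : {f : Sym2 (Fin n) → F // f ≠ 0})) := by
    intro T T' h
    have h1 : q T = q T' := congrArg Prod.fst h
    have h2 : g T = g T' := congrArg (fun x => x.2.1) h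
    refine Subtype.ext ?_
    rw [← hT, ← hT, NilpotentStructure.regularSubgroup_eq_iff]
    refine hext (fun i j => ?_) (fun x => ?_) (fun x => ?_)
    · have h3 : φ (q T) ((A T).mul (b (q T) i) (b (q T) j)) =
          φ (q T') ((A T').mul (b (q T') i) (b (q T') j)) := congrFun h2 s(i, j)
      rw [← hmul T, h3, h1, hmul]
    · rw [h1, hrep]
    · rw [h1, hrep']
  have := Nat.card_le_card_of_injective _ hinj
  rw [Nat.card_prod, Projectivization.card_of_finrank F V hn] at this
  refine this.trans (Nat.mul_le_mul_left _ (le_of_eq ?_))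
  have hc := Set.card_ne_eq (0 : Sym2 (Fin n) → F)
  rw [Fintype.card_fun, Sym2.card, Fintype.card_fin] at hc
  rw [Nat.card_eq_fintype_card, Nat.card_eq_fintype_card, ← hc]
  rfl

end UpperBound

/-! ### Automorphisms of the diagonal algebras -/

namespace NilpotentStructure

variable {F : Type*} [Field F]

/-- The symmetric bilinear form with matrix `diag(d₁, …, dₙ, 0)`. -/
def diagonalForm {n : ℕ} (d : Fin n → F) (x y : Fin (n + 1) → F) : F :=
  ∑ i : Fin n, d i * x i.castSucc * y i.castSucc

theorem diagonal_mul_apply {n : ℕ} (d : Fin n → F) (x y : Fin (n + 1) → F) :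
    (diagonal d).mul x y = Pi.single (Fin.last n) (diagonalForm d x y) := rfl

theorem diagonal_mul_eq_zero {n : ℕ} {d : Fin n → F} {x y : Fin (n + 1) → F} :
    (diagonal d).mul x y = 0 ↔ diagonalForm d x y = 0 := by
  rw [diagonal_mul_apply, Pi.single_eq_zero_iff]

theorem diagonalForm_three (d : Fin 3 → F) (x y : Fin 4 → F) :
    diagonalForm d x y = d 0 * x 0 * y 0 + d 1 * x 1 * y 1 + d 2 * x 2 * y 2 := by
  rw [diagonalForm, Fin.sum_univ_three]
  rfl

theorem diagonal_pow_three {n : ℕ} (d : Fin n → F) : (diagonal d).pow 3 = ⊥ := map₂_diagonalMul d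

theorem finrank_diagonal_pow_two {n : ℕ} {d : Fin n → F} (hd : d ≠ 0) :
    Module.finrank F ((diagonal d).pow 2) = 1 := by
  obtain ⟨i, hi⟩ := Function.ne_iff.1 hd
  have h : (diagonal d).pow 2 = Submodule.span F {Pi.single (Fin.last n) 1} := by
    rw [pow_two_eq]
    refine le_antisymm (Submodule.map₂_le.2 fun x _ y _ => ?_) ?_
    · rw [Submodule.mem_span_singleton]
      exact ⟨diagonalForm d x y, by rw [← Pi.single_smul, smul_eq_mul, mul_one]; rfl⟩
    · rw [Submodule.span_singleton_le_iff_mem]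
      have h1 : (diagonal d).mul (Pi.single i.castSucc (d i)⁻¹) (Pi.single i.castSucc 1) =
          Pi.single (Fin.last n) 1 := by
        rw [diagonal_mul_apply, diagonalForm, Finset.sum_eq_single i]
        · rw [Pi.single_eq_same, Pi.single_eq_same, mul_inv_cancel₀ hi, one_mul]
        · intro j _ hj
          rw [Pi.single_eq_of_ne (fun h => hj (Fin.castSucc_injective n h)), mul_zero, zero_mul]
        · exact fun h => absurd (Finset.mem_univ i) h
      rw [← h1]
      exact Submodule.apply_mem_map₂ _ Submodule.mem_top Submodule.mem_top
  rw [h, finrank_span_singleton]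
  exact fun h => one_ne_zero (Pi.single_eq_zero_iff.1 h)

theorem diagonalOrbit_subset {n : ℕ} {d : Fin n → F} (hd : d ≠ 0) :
    diagonalOrbit d ⊆ squareDimOneSubgroups F (Fin (n + 1) → F) :=
  conjOrbit_subset (finrank_diagonal_pow_two hd) (diagonal_pow_three d)

/-- An automorphism of a diagonal algebra is a similitude of the form. -/
theorem exists_multiplier {d : Fin 3 → F} (hd : d 0 = 1) {R : (Fin 4 → F) ≃ₗ[F] (Fin 4 → F)}
    (hR : R ∈ (diagonal d).automorphisms) :
    ∃ c : F, c ≠ 0 ∧ R (Pi.single 3 1) = Pi.single 3 c ∧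
      ∀ x y, diagonalForm d (R x) (R y) = c * diagonalForm d x y := by
  have h1 (x y) : R (Pi.single 3 (diagonalForm d x y)) =
      Pi.single 3 (diagonalForm d (R x) (R y)) := hR x y
  -- As `d 0 = 1`, the last basis vector is the square of the first; its image is thus on the same
  -- line, and the factor is the multiplier `c`.
  have h2 := h1 (Pi.single 0 1) (Pi.single 0 1)
  have h3 : diagonalForm d (Pi.single 0 1) (Pi.single 0 1) = 1 := by
    simp [diagonalForm_three, hd]
  rw [h3] at h2
  refine ⟨_, ?_, h2, fun x y => ?_⟩
  · intro h0
    rw [h0, Pi.single_zero, LinearEquiv.map_eq_zero_iff, Pi.single_eq_zero_iff] at h2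
    exact one_ne_zero h2
  · have h4 : (Pi.single 3 (diagonalForm d x y) : Fin 4 → F) =
        diagonalForm d x y • Pi.single 3 1 := by
      rw [← Pi.single_smul, smul_eq_mul, mul_one]
    have h5 := h1 x y
    rw [h4, map_smul, h2, ← Pi.single_smul, smul_eq_mul] at h5
    rw [← Pi.single_injective (M := fun _ : Fin 4 => F) 3 h5, mul_comm]

/-- The parameter set need only cover the automorphisms; parameters that give no automorphism do no
harm to an upper bound. -/
theorem ncard_automorphisms_le {V : Type*} [AddCommGroup V] [Module F V]
    {A : NilpotentStructure F V} {Y X : Type*} [Finite X] (f : (V ≃ₗ[F] V) → Y)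
    (hf : Function.Injective f) (g : X → Y) (h : ∀ R ∈ A.automorphisms, ∃ x, f R = g x) :
    A.automorphisms.ncard ≤ Nat.card X := by
  have : Nonempty X := (h (LinearEquiv.refl F V) fun _ _ => rfl).nonempty
  choose! x hx using h
  rw [← Set.ncard_univ]
  refine Set.ncard_le_ncard_of_injOn x (fun _ _ => Set.mem_univ _) (fun R hR S hS e => hf ?_)
  rw [hx R hR, hx S hS, e]

theorem toMatrix_injective : Function.Injective
    fun (R : (Fin 4 → F) ≃ₗ[F] (Fin 4 → F)) => Matrix.of fun i j => R (Pi.single j 1) i := by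
  intro R S h
  refine LinearEquiv.toLinearMap_injective (LinearMap.pi_ext' fun j => LinearMap.ext_ring ?_)
  exact funext fun i => congrFun (congrFun h i) j

/-- The vector of `F⁴` with light cone coordinates `x₀ - x₁ = a` and `x₀ + x₁ = b`, and with last
coordinates `z` and `k`. -/
def lightCone (a b z k : F) : Fin 4 → F := ![(a + b) / 2, (b - a) / 2, z, k]

theorem eq_lightCone (h2 : (2 : F) ≠ 0) (x : Fin 4 → F) :
    x = lightCone (x 0 - x 1) (x 0 + x 1) (x 2) (x 3) := by
  funext i
  fin_cases i
  · simp [lightCone]; field_simp; ring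
  · simp [lightCone]; field_simp; ring
  · simp [lightCone]
  · simp [lightCone]

/-- The images of a basis under a similitude of the form `x₀² - x₁² - x₂²`. -/
def lightConeParam (p : ((Fˣ × F) ⊕ Fˣ) × (F × Fˣ) × (Fin 3 → F)) : Fin 4 → Fin 4 → F :=
  -- The basis is `e₀ + e₁`, `e₂`, `e₀ - e₁`, `e₃`. In light cone coordinates the form is `ab - z²`,
  -- and the image of `e₀ + e₁` is a null vector: either `(a, t²a, ta)` with `a ≠ 0`, or `(0, b,
  -- 0)`. The multiplier is `l²`, and `k` holds the components along `e₃`.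
  match p with
  | (Sum.inl (a, t), (m, l), k) =>
    ![lightCone a (t ^ 2 * a) (t * a) (k 0),
      lightCone (m * a) (m * t ^ 2 * a + 2 * l * t) (m * t * a + l) (k 1),
      lightCone (m ^ 2 * a) (m ^ 2 * t ^ 2 * a + 4 * l * m * t + 4 * l ^ 2 / a)
        (m ^ 2 * t * a + 2 * l * m) (k 2),
      Pi.single 3 (l ^ 2 : F)]
  | (Sum.inr b, (m, l), k) =>
    ![lightCone 0 b 0 (k 0), lightCone 0 m l (k 1),
      lightCone (4 * l ^ 2 / b) (m ^ 2 / b) (2 * l * m / b) (k 2), Pi.single 3 (l ^ 2 : F)]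

theorem lightConeImages_injective (h2 : (2 : F) ≠ 0) : Function.Injective
    fun (R : (Fin 4 → F) ≃ₗ[F] (Fin 4 → F)) =>
      ![R (Pi.single 0 1 + Pi.single 1 1), R (Pi.single 2 1),
        R (Pi.single 0 1 - Pi.single 1 1), R (Pi.single 3 1)] := by
  intro R S h
  have e0 := congrFun h 0
  have e1 := congrFun h 1
  have e2 := congrFun h 2
  have e3 := congrFun h 3
  simp only [Matrix.cons_val_zero, Matrix.cons_val_one, Matrix.cons_val, map_add, map_sub]
    at e0 e1 e2 e3
  have f0 : R (Pi.single 0 1) = S (Pi.single 0 1) := by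
    refine funext fun i => mul_left_cancel₀ h2 ?_
    have e0 := congrFun e0 i
    have e2 := congrFun e2 i
    simp only [Pi.add_apply, Pi.sub_apply] at e0 e2
    linear_combination e0 + e2
  have f1 : R (Pi.single 1 1) = S (Pi.single 1 1) := by
    rw [f0] at e0
    exact add_left_cancel e0
  refine LinearEquiv.toLinearMap_injective (LinearMap.pi_ext' fun j => LinearMap.ext_ring ?_)
  fin_cases j
  · exact f0
  · exact f1
  · exact e1
  · exact e3

variable [Finite F]

theorem ncard_automorphisms_rank_one :
    (diagonal ![(1 : F), 0, 0]).automorphisms.ncard ≤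
      Nat.card (Fˣ × (Fin 3 → F) × GL (Fin 2) F × (Fin 2 → F)) := by
  refine ncard_automorphisms_le _ toMatrix_injective
    (fun p => !![(p.1 : F), 0, 0, 0; p.2.1 0, p.2.2.1.1 0 0, p.2.2.1.1 0 1, 0;
      p.2.1 1, p.2.2.1.1 1 0, p.2.2.1.1 1 1, 0;
      p.2.1 2, p.2.2.2 0, p.2.2.2 1, p.1 ^ 2]) fun R hR => ?_
  obtain ⟨c, hc, h3, hβ⟩ := exists_multiplier rfl hR
  simp only [diagonalForm_three, Matrix.cons_val_zero, Matrix.cons_val_one, Matrix.cons_val,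
    one_mul, zero_mul, add_zero] at hβ
  have h00 := hβ (Pi.single 0 1) (Pi.single 0 1)
  have h11 := hβ (Pi.single 1 1) (Pi.single 1 1)
  have h22 := hβ (Pi.single 2 1) (Pi.single 2 1)
  simp at h00 h11 h22
  have ha : R (Pi.single 0 1) 0 ≠ 0 := by
    intro h
    rw [h, zero_mul] at h00
    exact hc h00.symm
  -- A kernel vector of this block would give a combination of `e₁`, `e₂` whose image lies on the
  -- line of `e₃ = R(e₃)/c`, against injectivity.
  have hdet : (!![R (Pi.single 1 1) 1, R (Pi.single 2 1) 1;
      R (Pi.single 1 1) 2, R (Pi.single 2 1) 2] : Matrix (Fin 2) (Fin 2) F).det ≠ 0 := by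
    rw [Ne, ← Matrix.exists_mulVec_eq_zero_iff]
    rintro ⟨v, hv, h⟩
    have e0 := congrFun h 0
    have e1 := congrFun h 1
    simp [Matrix.mulVec, dotProduct, Fin.sum_univ_two] at e0 e1
    have key : R (v 0 • Pi.single 1 1 + v 1 • Pi.single 2 1) =
        R (((v 0 * R (Pi.single 1 1) 3 + v 1 * R (Pi.single 2 1) 3) / c) • Pi.single 3 1) := by
      rw [map_add, map_smul, map_smul, map_smul, h3]
      funext i
      fin_cases i
      · simp [h11, h22]
      · simp; linear_combination e0
      · simp; linear_combination e1
      · simp; field_simp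
    have := R.injective key
    apply hv
    funext i
    fin_cases i
    · simpa using congrFun this 1
    · simpa using congrFun this 2
  refine ⟨(Units.mk0 _ ha, ![R (Pi.single 0 1) 1, R (Pi.single 0 1) 2, R (Pi.single 0 1) 3],
    Matrix.GeneralLinearGroup.mkOfDetNeZero _ hdet, ![R (Pi.single 1 1) 3, R (Pi.single 2 1) 3]),
    ?_⟩
  ext i j
  fin_cases i <;> fin_cases j <;>
    simp [h3, h11, h22, Matrix.GeneralLinearGroup.mkOfDetNeZero, Matrix.GeneralLinearGroup.mk',
      Matrix.unitOfDetInvertible]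
  rw [← h00, sq]

/-- Modulo the radical, a similitude of `x² + s y²` is determined by the image `(a, b)` of `e₀`, of
nonzero norm, and by the sign of its determinant. The parametrization of `(a, b)` is left open
because their number depends on whether `-s` is a square. -/
theorem ncard_automorphisms_rank_two {s : F} (hs : s ≠ 0) {X : Type*} [Finite X] (ab : X → F × F)
    (hab : ∀ a b : F, a ^ 2 + s * b ^ 2 ≠ 0 → ∃ x, ab x = (a, b)) :
    (diagonal ![(1 : F), s, 0]).automorphisms.ncard ≤
      Nat.card (X × Bool × (Fin 4 → F) × Fˣ × F) := by
  refine ncard_automorphisms_le _ toMatrix_injective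
    (fun p => !![(ab p.1).1, (if p.2.1 then 1 else -1) * (-s * (ab p.1).2), 0, 0;
      (ab p.1).2, (if p.2.1 then 1 else -1) * (ab p.1).1, 0, 0;
      p.2.2.1 0, p.2.2.1 2, p.2.2.2.1, 0;
      p.2.2.1 1, p.2.2.1 3, p.2.2.2.2, (ab p.1).1 ^ 2 + s * (ab p.1).2 ^ 2]) fun R hR => ?_
  obtain ⟨c, hc, h3, hβ⟩ := exists_multiplier rfl hR
  simp only [diagonalForm_three, Matrix.cons_val_zero, Matrix.cons_val_one, Matrix.cons_val,
    one_mul, zero_mul, add_zero] at hβ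
  have h00 := hβ (Pi.single 0 1) (Pi.single 0 1)
  have h01 := hβ (Pi.single 0 1) (Pi.single 1 1)
  have h11 := hβ (Pi.single 1 1) (Pi.single 1 1)
  have h02 := hβ (Pi.single 0 1) (Pi.single 2 1)
  have h12 := hβ (Pi.single 1 1) (Pi.single 2 1)
  simp at h00 h01 h11 h02 h12
  generalize ha : R (Pi.single 0 1) 0 = a at *
  generalize hb : R (Pi.single 0 1) 1 = b at *
  generalize hu : R (Pi.single 1 1) 0 = u at *
  generalize hw : R (Pi.single 1 1) 1 = w at *
  generalize hy : R (Pi.single 2 1) 0 = y at *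
  generalize hz : R (Pi.single 2 1) 1 = z at *
  obtain ⟨x, hx⟩ := hab a b (by intro h; apply hc; linear_combination h - h00)
  -- Compare Gram determinants: the one of the images is `s` times the squared determinant, and it
  -- equals `s c²`.
  have hdet : (a * w - b * u) ^ 2 = c ^ 2 := by
    refine mul_left_cancel₀ hs ?_
    linear_combination (u * u + s * w * w) * h00 + c * h11 - (a * u + s * b * w) * h01
  have hne : a * w - b * u ≠ 0 := fun h => hc (by simpa [h] using hdet.symm)
  have hy0 : y = 0 := by
    refine (mul_eq_zero.1 (?_ : (a * w - b * u) * y = 0)).resolve_left hne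
    linear_combination w * h02 - b * h12
  have hz0 : z = 0 := by
    refine (mul_eq_zero.1 (?_ : (s * (a * w - b * u)) * z = 0)).resolve_left (mul_ne_zero hs hne)
    linear_combination a * h12 - u * h02
  have hm : R (Pi.single 2 1) 2 ≠ 0 := by
    intro hm
    have key : R (Pi.single 2 1) = R ((R (Pi.single 2 1) 3 / c) • Pi.single 3 1) := by
      rw [map_smul, h3]
      funext i
      fin_cases i
      · simp [hy, hy0]
      · simp [hz, hz0]
      · simp [hm]
      · simp; field_simp
    simpa using congrFun (R.injective key) 2
  have hl : ∃ l : Bool, a * w - b * u = (if l then 1 else -1) * c := by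
    rcases sq_eq_sq_iff_eq_or_eq_neg.1 hdet with h | h
    · exact ⟨true, by simp [h]⟩
    · exact ⟨false, by simp [h]⟩
  obtain ⟨l, hl⟩ := hl
  have hw' : w = (if l then 1 else -1) * a := by
    refine mul_left_cancel₀ hc ?_
    linear_combination (-w) * h00 + b * h01 + a * hl
  have hu' : u = (if l then 1 else -1) * (-s * b) := by
    refine mul_left_cancel₀ hc ?_
    linear_combination (-u) * h00 + a * h01 - s * b * hl
  refine ⟨(x, l, ![R (Pi.single 0 1) 2, R (Pi.single 0 1) 3, R (Pi.single 1 1) 2,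
    R (Pi.single 1 1) 3], Units.mk0 _ hm, R (Pi.single 2 1) 3), ?_⟩
  ext i j
  fin_cases i <;> fin_cases j <;> simp [h3, hx, ha, hb, hu, hw, hy, hz, hy0, hz0]
  · simpa using hu'
  · cases l <;> simpa using hw'
  · rw [← h00]; ring

/-- The form `x₀² - x₁² - x₂²` replaces the sum of three squares because it has an explicit
hyperbolic plane. A similitude is then found by solving for the images of two null vectors and of
`e₂`, one Gram equation at a time. -/
theorem ncard_automorphisms_rank_three (h2 : (2 : F) ≠ 0) :
    (diagonal ![(1 : F), -1, -1]).automorphisms.ncard ≤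
      Nat.card (((Fˣ × F) ⊕ Fˣ) × (F × Fˣ) × (Fin 3 → F)) := by
  refine ncard_automorphisms_le _ (lightConeImages_injective h2) lightConeParam fun R hR => ?_
  obtain ⟨c, hc, h3, hβ⟩ := exists_multiplier rfl hR
  simp only [diagonalForm_three, Matrix.cons_val_zero, Matrix.cons_val_one, Matrix.cons_val,
    one_mul] at hβ
  have hxx := hβ (Pi.single 0 1 + Pi.single 1 1) (Pi.single 0 1 + Pi.single 1 1)
  have hxy := hβ (Pi.single 0 1 + Pi.single 1 1) (Pi.single 2 1)
  have hyy := hβ (Pi.single 2 1) (Pi.single 2 1)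
  have hxw := hβ (Pi.single 0 1 + Pi.single 1 1) (Pi.single 0 1 - Pi.single 1 1)
  have hyw := hβ (Pi.single 2 1) (Pi.single 0 1 - Pi.single 1 1)
  have hww := hβ (Pi.single 0 1 - Pi.single 1 1) (Pi.single 0 1 - Pi.single 1 1)
  have hx0 : R (Pi.single 0 1 + Pi.single 1 1) = lightCone _ _ _ _ := eq_lightCone h2 _
  have hy0 : R (Pi.single 2 1) = lightCone _ _ _ _ := eq_lightCone h2 _
  have hw0 : R (Pi.single 0 1 - Pi.single 1 1) = lightCone _ _ _ _ := eq_lightCone h2 _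
  generalize R (Pi.single 0 1 + Pi.single 1 1) = x at *
  generalize R (Pi.single 2 1) = y at *
  generalize R (Pi.single 0 1 - Pi.single 1 1) = w at *
  obtain ⟨a, ha⟩ : ∃ a, a = x 0 - x 1 := ⟨_, rfl⟩
  obtain ⟨b, hb⟩ : ∃ b, b = x 0 + x 1 := ⟨_, rfl⟩
  obtain ⟨a', ha'⟩ : ∃ a', a' = y 0 - y 1 := ⟨_, rfl⟩
  obtain ⟨b', hb'⟩ : ∃ b', b' = y 0 + y 1 := ⟨_, rfl⟩
  obtain ⟨a'', ha''⟩ : ∃ a'', a'' = w 0 - w 1 := ⟨_, rfl⟩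
  obtain ⟨b'', hb''⟩ : ∃ b'', b'' = w 0 + w 1 := ⟨_, rfl⟩
  rw [← ha, ← hb] at hx0
  rw [← ha', ← hb'] at hy0
  rw [← ha'', ← hb''] at hw0
  simp at hxx hxy hyy hxw hyw hww
  have exx : a * b = x 2 ^ 2 := by rw [ha, hb]; linear_combination hxx
  have exy : a * b' + a' * b = 2 * (x 2 * y 2) := by
    rw [ha, hb, ha', hb']; linear_combination 2 * hxy
  have eyy : y 2 ^ 2 - a' * b' = c := by rw [ha', hb']; linear_combination -hyy
  have exw : a * b'' + a'' * b = 2 * (x 2 * w 2) + 4 * c := by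
    rw [ha, hb, ha'', hb'']; linear_combination 2 * hxw
  have eyw : a' * b'' + a'' * b' = 2 * (y 2 * w 2) := by
    rw [ha', hb', ha'', hb'']; linear_combination 2 * hyw
  have eww : a'' * b'' = w 2 ^ 2 := by rw [ha'', hb'']; linear_combination hww
  generalize x 2 = z at *
  generalize y 2 = z' at *
  generalize w 2 = z'' at *
  rw [hx0, hy0, hw0, h3]
  clear hx0 hy0 hw0 ha hb ha' hb' ha'' hb'' hxx hxy hyy hxw hyw hww hβ hR h3
  have h4 : (4 : F) ≠ 0 := by
    rw [show (4 : F) = 2 * 2 by norm_num]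
    exact mul_ne_zero h2 h2
  by_cases ha : a = 0
  · subst ha
    obtain rfl : z = 0 := by simpa using exx.symm
    have hb : b ≠ 0 := by
      rintro rfl
      simp [h4, hc] at exw
    obtain rfl : a' = 0 := by simpa [hb] using exy
    have hc' : c = z' ^ 2 := by linear_combination -eyy
    have hz' : z' ≠ 0 := by
      rintro rfl
      exact hc (by simpa using hc')
    have e1 : a'' = 4 * z' ^ 2 / b := by
      field_simp
      linear_combination exw + 4 * hc'
    have e2 : z'' = 2 * z' * b' / b := by
      have := eyw
      rw [e1] at this
      field_simp at this
      rw [eq_div_iff hb]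
      refine mul_left_cancel₀ (mul_ne_zero h2 hz') ?_
      linear_combination -this
    have e3 : b'' = b' ^ 2 / b := by
      have := eww
      rw [e1, e2] at this
      field_simp at this
      rw [eq_div_iff hb]
      refine mul_left_cancel₀ h4 ?_
      linear_combination this
    refine ⟨(Sum.inr (Units.mk0 b hb), (b', Units.mk0 z' hz'), ![x 3, y 3, w 3]), ?_⟩
    rw [e1, e2, e3, hc']
    rfl
  -- Here `a ≠ 0`. Measuring the other vectors relative to `x` makes the system triangular: the six
  -- equations yield `b`, `b'`, `c = l²`, `b''`, `r = 2lm` and `n = m²` in turn.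
  · obtain ⟨t, rfl⟩ : ∃ t, z = t * a := ⟨z / a, by field_simp⟩
    obtain ⟨m, rfl⟩ : ∃ m, a' = m * a := ⟨a' / a, by field_simp⟩
    obtain ⟨n, rfl⟩ : ∃ n, a'' = n * a := ⟨a'' / a, by field_simp⟩
    obtain ⟨l, rfl⟩ : ∃ l, z' = m * t * a + l := ⟨z' - m * t * a, by ring⟩
    obtain ⟨r, rfl⟩ : ∃ r, z'' = n * t * a + r := ⟨z'' - n * t * a, by ring⟩
    obtain rfl : b = t ^ 2 * a := mul_left_cancel₀ ha (by linear_combination exx)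
    obtain rfl : b' = m * t ^ 2 * a + 2 * l * t :=
      mul_left_cancel₀ ha (by linear_combination exy)
    obtain rfl : c = l ^ 2 := by linear_combination -eyy
    have hl : l ≠ 0 := fun h => hc (by simp [h])
    obtain rfl : b'' = n * t ^ 2 * a + 2 * r * t + 4 * l ^ 2 / a :=
      mul_left_cancel₀ ha (by field_simp; linear_combination exw)
    obtain rfl : r = 2 * l * m := by
      refine mul_left_cancel₀ (mul_ne_zero h2 hl) ?_
      field_simp at eyw
      linear_combination -eyw
    obtain rfl : n = m ^ 2 := by
      refine mul_left_cancel₀ (mul_ne_zero h4 (pow_ne_zero 2 hl)) ?_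
      field_simp at eww
      linear_combination eww
    refine ⟨(Sum.inl (Units.mk0 a ha, t), (m, Units.mk0 l hl), ![x 3, y 3, w 3]), ?_⟩
    have e : m ^ 2 * t ^ 2 * a + 2 * (2 * l * m) * t + 4 * l ^ 2 / a =
      m ^ 2 * t ^ 2 * a + 4 * l * m * t + 4 * l ^ 2 / a := by ring
    rw [e]
    rfl

end NilpotentStructure

/-! ### Disjointness of the four orbits -/

namespace NilpotentStructure

section Disjoint

variable {F : Type*} [Field F]

theorem diagonalForm_eq_zero_iff {d d' : Fin 3 → F} {R : (Fin 4 → F) ≃ₗ[F] (Fin 4 → F)}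
    (hR : ∀ x y, R ((diagonal d).mul x y) = (diagonal d').mul (R x) (R y)) (x y : Fin 4 → F) :
    diagonalForm d x y = 0 ↔ diagonalForm d' (R x) (R y) = 0 := by
  rw [← diagonal_mul_eq_zero, ← diagonal_mul_eq_zero, ← hR, LinearEquiv.map_eq_zero_iff]

/-- In the rank one algebra `xy = 0` forces `x² = 0` or `y² = 0`; the first two basis vectors
violate this for the other form. -/
theorem disjoint_rank_one {d : Fin 3 → F} (h0 : d 0 ≠ 0) (h1 : d 1 ≠ 0) :
    Disjoint (diagonalOrbit ![1, 0, 0]) (diagonalOrbit d) := by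
  refine disjoint_conjOrbit fun R hR => ?_
  have h01 := (diagonalForm_eq_zero_iff hR (R.symm (Pi.single 0 1)) (R.symm (Pi.single 1 1))).2
    (by simp [diagonalForm_three])
  have h00 := mt (diagonalForm_eq_zero_iff hR (R.symm (Pi.single 0 1)) (R.symm (Pi.single 0 1))).1
    (by simp [diagonalForm_three, h0])
  have h11 := mt (diagonalForm_eq_zero_iff hR (R.symm (Pi.single 1 1)) (R.symm (Pi.single 1 1))).1
    (by simp [diagonalForm_three, h1])
  simp only [diagonalForm_three, Matrix.cons_val_zero, Matrix.cons_val_one, Matrix.cons_val,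
    one_mul, zero_mul, add_zero, mul_self_eq_zero] at h01 h00 h11
  exact mul_ne_zero h00 h11 h01

/-- A form of rank two has no three mutually orthogonal non-isotropic vectors: the first two span it
modulo the radical, so the third lies in the radical. -/
theorem disjoint_rank_two_rank_three {s : F} (hs : s ≠ 0) {d : Fin 3 → F} (hd : ∀ i, d i ≠ 0) :
    Disjoint (diagonalOrbit ![1, s, 0]) (diagonalOrbit d) := by
  refine disjoint_conjOrbit fun R hR => ?_
  have h (i j : Fin 4) := diagonalForm_eq_zero_iff hR (R.symm (Pi.single i 1))
    (R.symm (Pi.single j 1))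
  simp only [LinearEquiv.apply_symm_apply] at h
  have h01 := (h 0 1).2 (by simp [diagonalForm_three])
  have h02 := (h 0 2).2 (by simp [diagonalForm_three])
  have h12 := (h 1 2).2 (by simp [diagonalForm_three])
  have h00 := mt (h 0 0).1 (by simp [diagonalForm_three, hd])
  have h11 := mt (h 1 1).1 (by simp [diagonalForm_three, hd])
  have h22 := mt (h 2 2).1 (by simp [diagonalForm_three, hd])
  simp only [diagonalForm_three, Matrix.cons_val_zero, Matrix.cons_val_one, Matrix.cons_val,
    one_mul, zero_mul, add_zero] at h01 h02 h12 h00 h11 h22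
  generalize R.symm (Pi.single 0 1) = x at *
  generalize R.symm (Pi.single 1 1) = y at *
  generalize R.symm (Pi.single 2 1) = z at *
  have hD : x 0 * y 1 - x 1 * y 0 ≠ 0 := by
    intro hD
    refine mul_ne_zero h00 h11 ?_
    linear_combination s * (x 0 * y 1 - x 1 * y 0) * hD + (x 0 * y 0 + s * x 1 * y 1) * h01
  have hz0 : z 0 = 0 := by
    refine (mul_eq_zero.1 (?_ : (x 0 * y 1 - x 1 * y 0) * z 0 = 0)).resolve_left hD
    linear_combination y 1 * h02 - x 1 * h12
  have hz1 : z 1 = 0 := by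
    refine (mul_eq_zero.1 (?_ : (s * (x 0 * y 1 - x 1 * y 0)) * z 1 = 0)).resolve_left
      (mul_ne_zero hs hD)
    linear_combination x 0 * h12 - y 0 * h02
  exact h22 (by rw [hz0, hz1]; ring)

/-- The distinguishing property is a null vector outside the radical. If `-s = r²`, then `(r, 1, 0,
0)` is one; for `x² + t y²` it would make `-t` a square. -/
theorem disjoint_rank_two {s t : F} (hs : s ≠ 0) (h1 : IsSquare (-s)) (h2 : ¬ IsSquare (-t)) :
    Disjoint (diagonalOrbit ![1, s, 0]) (diagonalOrbit ![1, t, 0]) := by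
  refine disjoint_conjOrbit fun R hR => ?_
  obtain ⟨r, hr⟩ := h1
  have hxx := (diagonalForm_eq_zero_iff hR ![r, 1, 0, 0] ![r, 1, 0, 0]).1
    (by simp [diagonalForm_three, ← hr])
  have hxy := mt (diagonalForm_eq_zero_iff hR ![r, 1, 0, 0] (Pi.single 0 1)).2 (by
    simp only [diagonalForm_three]
    rintro h
    obtain rfl : r = 0 := by simpa using h
    exact hs (by simpa using hr))
  generalize R ![r, 1, 0, 0] = x at *
  simp only [diagonalForm_three, Matrix.cons_val_zero, Matrix.cons_val_one, Matrix.cons_val,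
    one_mul, zero_mul, add_zero] at hxx hxy
  by_cases hx : x 1 = 0
  · have hx0 : x 0 = 0 := by simpa [hx] using hxx
    exact hxy (by rw [hx, hx0]; ring)
  · refine h2 ⟨x 0 / x 1, ?_⟩
    field_simp
    linear_combination -hxx

/-- The automorphism of `F⁴` that rotates the coordinates `x₁`, `x₂` by a matrix of
determinant `-1`. -/
def rotation {a b : F} (hab : a ^ 2 + b ^ 2 = -1) : (Fin 4 → F) ≃ₗ[F] (Fin 4 → F) where
  toFun x := ![x 0, a * x 1 - b * x 2, b * x 1 + a * x 2, x 3]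
  map_add' x y := by
    funext i
    fin_cases i <;> simp <;> ring
  map_smul' c x := by
    funext i
    fin_cases i <;> simp <;> ring
  invFun x := ![x 0, -(a * x 1 + b * x 2), b * x 1 - a * x 2, x 3]
  left_inv x := by
    funext i
    fin_cases i <;> simp
    · linear_combination (-x 1) * hab
    · linear_combination (-x 2) * hab
  right_inv x := by
    funext i
    fin_cases i <;> simp
    · linear_combination (-x 1) * hab
    · linear_combination (-x 2) * hab

/-- The matrix with rows `(a, -b)`, `(b, a)` multiplies the sum of two squares by `a² + b² = -1`. -/
theorem diagonalOrbit_neg_one {a b : F} (hab : a ^ 2 + b ^ 2 = -1) :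
    diagonalOrbit ![(1 : F), -1, -1] = diagonalOrbit ![1, 1, 1] := by
  refine conjOrbit_eq_of_map (rotation hab) fun x y => ?_
  have h : diagonalForm ![(1 : F), 1, 1] (rotation hab x) (rotation hab y) =
      diagonalForm ![(1 : F), -1, -1] x y := by
    simp [diagonalForm_three, rotation]
    linear_combination (x 1 * y 1 + x 2 * y 2) * hab
  rw [diagonal_mul_apply, diagonal_mul_apply, h]
  funext i
  fin_cases i <;> simp [rotation, Fin.ext_iff]

end Disjoint

/-! ### Numerical bounds for the orbits -/

section Count

variable {F : Type*} [Field F] [Finite F]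

theorem card_linearEquiv_four : (Nat.card ((Fin 4 → F) ≃ₗ[F] (Fin 4 → F)) : ℚ) =
    ((Nat.card F : ℚ) ^ 4 - 1) * (Nat.card F ^ 4 - Nat.card F) * (Nat.card F ^ 4 - Nat.card F ^ 2) *
      (Nat.card F ^ 4 - Nat.card F ^ 3) := by
  have := Fintype.ofFinite F
  rw [← Nat.card_congr ((Matrix.GeneralLinearGroup.toLin (n := Fin 4) (R := F)).trans
    (LinearMap.GeneralLinearGroup.generalLinearEquiv F (Fin 4 → F))).toEquiv,
    Matrix.card_GL_field, Nat.card_eq_fintype_card]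
  have hq : 1 ≤ Fintype.card F := Fintype.card_pos
  simp only [Fin.prod_univ_four, Fin.val_zero, Fin.val_one, pow_zero, pow_one]
  push_cast [Nat.cast_sub (Nat.one_le_pow 4 _ hq),
    Nat.cast_sub (Nat.le_self_pow (n := 4) (by norm_num) (Fintype.card F)),
    Nat.cast_sub (Nat.pow_le_pow_right hq (show 2 ≤ 4 by norm_num)),
    Nat.cast_sub (Nat.pow_le_pow_right hq (show 3 ≤ 4 by norm_num))]
  simp [Nat.cast_sub (Nat.pow_le_pow_right hq (show 2 ≤ 4 by norm_num)),
    Nat.cast_sub (Nat.pow_le_pow_right hq (show 3 ≤ 4 by norm_num))]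

theorem card_GL_two : (Nat.card (GL (Fin 2) F) : ℚ) =
    ((Nat.card F : ℚ) ^ 2 - 1) * (Nat.card F ^ 2 - Nat.card F) := by
  have := Fintype.ofFinite F
  rw [Matrix.card_GL_field, Nat.card_eq_fintype_card]
  have hq : 1 ≤ Fintype.card F := Fintype.card_pos
  simp [Fin.prod_univ_two, Nat.cast_sub (Nat.one_le_pow 2 _ hq),
    Nat.cast_sub (Nat.le_self_pow (n := 2) (by norm_num) (Fintype.card F))]

theorem card_units_cast : (Nat.card Fˣ : ℚ) = (Nat.card F : ℚ) - 1 := by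
  rw [Nat.card_units, Nat.cast_sub Nat.card_pos, Nat.cast_one]

theorem one_lt_card : (1 : ℚ) < Nat.card F := by
  exact_mod_cast Finite.one_lt_card

theorem le_ncard_conjOrbit {A : NilpotentStructure F (Fin 4 → F)} {k n : ℚ} (hk : 0 < k)
    (h : (A.automorphisms.ncard : ℚ) ≤ k)
    (hn : k * n = ((Nat.card F : ℚ) ^ 4 - 1) * (Nat.card F ^ 4 - Nat.card F) *
      (Nat.card F ^ 4 - Nat.card F ^ 2) * (Nat.card F ^ 4 - Nat.card F ^ 3)) :
    n ≤ (conjOrbit F A.regularSubgroup).ncard := by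
  refine le_of_mul_le_mul_left ?_ hk
  rw [hn, ← card_linearEquiv_four]
  calc (Nat.card ((Fin 4 → F) ≃ₗ[F] (Fin 4 → F)) : ℚ)
      ≤ (A.automorphisms.ncard * (conjOrbit F A.regularSubgroup).ncard : ℕ) :=
        Nat.cast_le.2 A.card_linearEquiv_le
    _ = A.automorphisms.ncard * (conjOrbit F A.regularSubgroup).ncard := Nat.cast_mul _ _
    _ ≤ _ := mul_le_mul_of_nonneg_right h (Nat.cast_nonneg _)

theorem le_ncard_rank_one :
    ((Nat.card F : ℚ) ^ 2 + 1) * (Nat.card F + 1) * (Nat.card F ^ 3 - 1) ≤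
      (diagonalOrbit ![(1 : F), 0, 0]).ncard := by
  have hq := one_lt_card (F := F)
  have hk := Nat.cast_le (α := ℚ).2 (ncard_automorphisms_rank_one (F := F))
  simp only [Nat.card_prod, Nat.card_fun, Nat.cast_mul, Nat.cast_pow, card_GL_two,
    card_units_cast, Nat.card_fin] at hk
  refine le_ncard_conjOrbit ?_ hk (by ring)
  have h1 : (0 : ℚ) < Nat.card F - 1 := by linarith
  have h2 : (0 : ℚ) < (Nat.card F : ℚ) ^ 2 - 1 := by nlinarith
  have h3 : (0 : ℚ) < (Nat.card F : ℚ) ^ 2 - Nat.card F := by nlinarith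
  positivity

theorem le_ncard_rank_two_isSquare (h2 : (2 : F) ≠ 0) {s : F} (hs : s ≠ 0) (h : IsSquare (-s)) :
    (Nat.card F : ℚ) * ((Nat.card F : ℚ) ^ 2 + 1) * (Nat.card F ^ 3 - 1) * (Nat.card F + 1) ^ 2 / 2
      ≤ (diagonalOrbit ![(1 : F), s, 0]).ncard := by
  obtain ⟨r, hr⟩ := h
  have hr0 : r ≠ 0 := by
    rintro rfl
    exact hs (by simpa using hr)
  have hq := one_lt_card (F := F)
  have hk := Nat.cast_le (α := ℚ).2 (ncard_automorphisms_rank_two hs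
    -- Here `a² + s b² = (a - r b)(a + r b)`, so the admissible pairs correspond to the two unit
    -- factors, which number `(q - 1)²`.
    (fun x : Fˣ × Fˣ => ((x.1 + x.2 : F) / 2, (x.2 - x.1 : F) / (2 * r))) fun a b hab => by
      have h1 : (a - r * b) * (a + r * b) ≠ 0 := by
        intro h
        apply hab
        linear_combination h - b ^ 2 * hr
      refine ⟨(Units.mk0 _ (left_ne_zero_of_mul h1), Units.mk0 _ (right_ne_zero_of_mul h1)), ?_⟩
      refine Prod.ext ?_ ?_
      · simp; field_simp; ring
      · simp; field_simp; ring)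
  simp only [Nat.card_prod, Nat.card_fun, Nat.cast_mul, Nat.cast_pow, card_units_cast,
    Nat.card_fin, Nat.card_eq_fintype_card (α := Bool), Fintype.card_bool] at hk
  refine le_ncard_conjOrbit ?_ hk (by push_cast; ring)
  have h1 : (0 : ℚ) < Nat.card F - 1 := by linarith
  positivity

/-- All nonzero pairs `(a, b)` are allowed, which is wasteful when `-t` is a square; the bound is
sharp for an anisotropic plane. -/
theorem le_ncard_rank_two {t : F} (ht : t ≠ 0) :
    (Nat.card F : ℚ) * ((Nat.card F : ℚ) ^ 4 - 1) * (Nat.card F ^ 3 - 1) / 2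
      ≤ (diagonalOrbit ![(1 : F), t, 0]).ncard := by
  classical
  have := Fintype.ofFinite F
  have hq := one_lt_card (F := F)
  have hk := Nat.cast_le (α := ℚ).2 (ncard_automorphisms_rank_two ht
    (fun x : {x : F × F // x ≠ 0} => x.1) fun a b hab =>
      ⟨⟨(a, b), fun h => hab (by simp [(Prod.mk.inj h).1, (Prod.mk.inj h).2])⟩, rfl⟩)
  have hc : (Nat.card {x : F × F // x ≠ 0} : ℚ) = (Nat.card F : ℚ) ^ 2 - 1 := by
    have h := Set.card_ne_eq (0 : F × F)
    rw [Fintype.card_prod, ← Nat.card_eq_fintype_card, ← Nat.card_eq_fintype_card] at h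
    change Nat.card {x : F × F // x ≠ 0} = _ at h
    rw [h, Nat.cast_sub (Nat.mul_pos Nat.card_pos Nat.card_pos)]
    push_cast
    ring
  simp only [Nat.card_prod, Nat.card_fun, Nat.cast_mul, Nat.cast_pow, card_units_cast, hc,
    Nat.card_fin, Nat.card_eq_fintype_card (α := Bool), Fintype.card_bool] at hk
  refine le_ncard_conjOrbit ?_ hk (by push_cast; ring)
  have h1 : (0 : ℚ) < Nat.card F - 1 := by linarith
  have h2 : (0 : ℚ) < (Nat.card F : ℚ) ^ 2 - 1 := by nlinarith
  positivity

theorem le_ncard_rank_three (h2 : (2 : F) ≠ 0) {a b : F} (hab : a ^ 2 + b ^ 2 = -1) :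
    (Nat.card F : ℚ) ^ 2 * ((Nat.card F : ℚ) ^ 4 - 1) * (Nat.card F ^ 3 - 1)
      ≤ (diagonalOrbit ![(1 : F), 1, 1]).ncard := by
  rw [← diagonalOrbit_neg_one hab]
  have hq := one_lt_card (F := F)
  have hk := Nat.cast_le (α := ℚ).2 (ncard_automorphisms_rank_three h2)
  simp only [Nat.card_prod, Nat.card_sum, Nat.card_fun, Nat.cast_mul, Nat.cast_add, Nat.cast_pow,
    card_units_cast, Nat.card_fin] at hk
  refine le_ncard_conjOrbit ?_ hk (by ring)
  have h1 : (0 : ℚ) < Nat.card F - 1 := by linarith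
  positivity

theorem ncard_squareDimOneSubgroups_le :
    ((squareDimOneSubgroups F (Fin 4 → F)).ncard : ℚ) ≤
      ((Nat.card F : ℚ) ^ 3 + Nat.card F ^ 2 + Nat.card F + 1) * (Nat.card F ^ 6 - 1) := by
  have h := Nat.cast_le (α := ℚ).2 (card_squareDimOneSubgroups_le (F := F) (V := Fin 4 → F) (n := 3)
    (by simp))
  refine h.trans (le_of_eq ?_)
  have h6 : (3 + 1).choose 2 = 6 := rfl
  rw [h6, Nat.cast_mul, Nat.cast_sub (Nat.one_le_pow _ _ Nat.card_pos)]
  simp only [Finset.sum_range_succ, Finset.sum_range_zero]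
  push_cast
  ring

end Count

end NilpotentStructure

/-! ### The sandwich and the main theorem -/

namespace NilpotentStructure

/-- The four orbits exhaust the set of subgroups, and have the expected sizes. -/
theorem squareDimOneSubgroups_classification {F : Type*} [Field F] [Finite F]
    (h2 : (2 : F) ≠ 0) {a b : F} (hab : a ^ 2 + b ^ 2 = -1) {s t : F} (hs : s ≠ 0)
    (hs' : IsSquare (-s)) (ht : ¬ IsSquare (-t)) :
    (squareDimOneSubgroups F (Fin 4 → F) = diagonalOrbit ![1, 0, 0] ∪ diagonalOrbit ![1, s, 0] ∪
      diagonalOrbit ![1, t, 0] ∪ diagonalOrbit ![1, 1, 1]) ∧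
    [diagonalOrbit ![1, 0, 0], diagonalOrbit ![1, s, 0], diagonalOrbit ![1, t, 0],
      diagonalOrbit ![1, 1, (1 : F)]].Pairwise Disjoint ∧
    ((diagonalOrbit ![(1 : F), 0, 0]).ncard : ℚ) =
      ((Nat.card F : ℚ) ^ 2 + 1) * (Nat.card F + 1) * (Nat.card F ^ 3 - 1) ∧
    ((diagonalOrbit ![1, s, 0]).ncard : ℚ) = Nat.card F * ((Nat.card F : ℚ) ^ 2 + 1) *
      (Nat.card F ^ 3 - 1) * (Nat.card F + 1) ^ 2 / 2 ∧
    ((diagonalOrbit ![1, t, 0]).ncard : ℚ) =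
      Nat.card F * ((Nat.card F : ℚ) ^ 4 - 1) * (Nat.card F ^ 3 - 1) / 2 ∧
    ((diagonalOrbit ![(1 : F), 1, 1]).ncard : ℚ) =
      (Nat.card F : ℚ) ^ 2 * (Nat.card F ^ 4 - 1) * (Nat.card F ^ 3 - 1) ∧
    ((squareDimOneSubgroups F (Fin 4 → F)).ncard : ℚ) =
      ((Nat.card F : ℚ) ^ 3 + Nat.card F ^ 2 + Nat.card F + 1) * (Nat.card F ^ 6 - 1) := by
  have ht0 : t ≠ 0 := by
    rintro rfl
    exact ht ⟨0, by simp⟩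
  have h13 : ∀ i, (![1, 1, 1] : Fin 3 → F) i ≠ 0 := by
    intro i
    fin_cases i <;> simp
  have d12 : Disjoint (diagonalOrbit ![(1 : F), 0, 0]) (diagonalOrbit ![1, s, 0]) :=
    disjoint_rank_one (by simp) (by simpa)
  have d13 : Disjoint (diagonalOrbit ![(1 : F), 0, 0]) (diagonalOrbit ![1, t, 0]) :=
    disjoint_rank_one (by simp) (by simpa)
  have d14 : Disjoint (diagonalOrbit ![(1 : F), 0, 0]) (diagonalOrbit ![1, 1, 1]) :=
    disjoint_rank_one (by simp) (by simp)
  have d23 := disjoint_rank_two hs hs' ht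
  have d24 : Disjoint (diagonalOrbit ![1, s, 0]) (diagonalOrbit ![1, 1, 1]) :=
    disjoint_rank_two_rank_three hs h13
  have d34 : Disjoint (diagonalOrbit ![1, t, 0]) (diagonalOrbit ![1, 1, 1]) :=
    disjoint_rank_two_rank_three ht0 h13
  have hfin (U : Set (Subgroup (Equiv.Perm (Fin 4 → F)))) : U.Finite := by
    have : Finite (Subgroup (Equiv.Perm (Fin 4 → F))) := inferInstance
    exact Set.toFinite U
  have hsub (d : Fin 3 → F) (hd : d 0 = 1) :
      diagonalOrbit d ⊆ squareDimOneSubgroups F (Fin 4 → F) :=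
    diagonalOrbit_subset fun h => by simp [h] at hd
  have hU : diagonalOrbit ![1, 0, 0] ∪ diagonalOrbit ![1, s, 0] ∪ diagonalOrbit ![1, t, 0] ∪
      diagonalOrbit ![1, 1, 1] ⊆ squareDimOneSubgroups F (Fin 4 → F) :=
    Set.union_subset (Set.union_subset (Set.union_subset (hsub _ rfl) (hsub _ rfl)) (hsub _ rfl))
      (hsub _ rfl)
  have hcard : (diagonalOrbit ![1, 0, 0] ∪ diagonalOrbit ![1, s, 0] ∪ diagonalOrbit ![1, t, 0] ∪
      diagonalOrbit ![1, 1, 1]).ncard = (diagonalOrbit ![(1 : F), 0, 0]).ncard +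
        (diagonalOrbit ![1, s, 0]).ncard + (diagonalOrbit ![1, t, 0]).ncard +
          (diagonalOrbit ![(1 : F), 1, 1]).ncard := by
    rw [Set.ncard_union_eq (by simp [d14, d24, d34]) (hfin _) (hfin _),
      Set.ncard_union_eq (by simp [d13, d23]) (hfin _) (hfin _),
      Set.ncard_union_eq d12 (hfin _) (hfin _)]
  have hle := Set.ncard_le_ncard hU (hfin _)
  have hleQ := Nat.cast_le (α := ℚ).2 hle
  have hcardQ := congrArg (Nat.cast (R := ℚ)) hcard
  push_cast at hcardQ
  have l1 := le_ncard_rank_one (F := F)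
  have l2 := le_ncard_rank_two_isSquare h2 hs hs'
  have l3 := le_ncard_rank_two ht0
  have l4 := le_ncard_rank_three h2 hab
  have l5 := ncard_squareDimOneSubgroups_le (F := F)
  generalize (Nat.card F : ℚ) = q at *
  -- The decisive identity: the four lower bounds sum to the upper bound.
  have hsum : (q ^ 2 + 1) * (q + 1) * (q ^ 3 - 1) +
      q * (q ^ 2 + 1) * (q ^ 3 - 1) * (q + 1) ^ 2 / 2 + q * (q ^ 4 - 1) * (q ^ 3 - 1) / 2 +
      q ^ 2 * (q ^ 4 - 1) * (q ^ 3 - 1) = (q ^ 3 + q ^ 2 + q + 1) * (q ^ 6 - 1) := by ring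
  refine ⟨?_, by simp [d12, d13, d14, d23, d24, d34], ?_, ?_, ?_, ?_, ?_⟩
  · refine (Set.eq_of_subset_of_ncard_le hU ?_ (hfin _)).symm
    rw [← Nat.cast_le (α := ℚ)]
    linarith
  -- With no slack in the total, none of the four lower bounds can be strict.
  all_goals linarith

end NilpotentStructure

theorem mainTheorem7 (p : ℕ) [Fact p.Prime] (hp : p ≠ 2) :
    -- the subgroups in question are regular subgroups of the holomorph
    (∀ T ∈ squareDimOneSubgroups (ZMod p) (Fin 4 → ZMod p),
      IsRegularSubgroup T ∧ T ≤ holomorph (Fin 4 → ZMod p)) ∧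
    -- they form four orbits, of the stated sizes
    (∀ s t : ZMod p, s ≠ 0 → IsSquare (-s) → ¬ IsSquare (-t) →
      squareDimOneSubgroups (ZMod p) (Fin 4 → ZMod p) =
        diagonalOrbit ![1, 0, 0] ∪ diagonalOrbit ![1, s, 0] ∪ diagonalOrbit ![1, t, 0] ∪
          diagonalOrbit ![1, 1, 1] ∧
      [diagonalOrbit ![1, 0, 0], diagonalOrbit ![1, s, 0], diagonalOrbit ![1, t, 0],
        diagonalOrbit ![1, 1, (1 : ZMod p)]].Pairwise Disjoint ∧
      ((diagonalOrbit ![(1 : ZMod p), 0, 0]).ncard : ℚ) =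
        ((p : ℚ) ^ 2 + 1) * (p + 1) * (p ^ 3 - 1) ∧
      ((diagonalOrbit ![1, s, 0]).ncard : ℚ) =
        p * ((p : ℚ) ^ 2 + 1) * (p ^ 3 - 1) * (p + 1) ^ 2 / 2 ∧
      ((diagonalOrbit ![1, t, 0]).ncard : ℚ) =
        p * ((p : ℚ) ^ 4 - 1) * (p ^ 3 - 1) / 2 ∧
      ((diagonalOrbit ![(1 : ZMod p), 1, 1]).ncard : ℚ) =
        (p : ℚ) ^ 2 * (p ^ 4 - 1) * (p ^ 3 - 1)) ∧
    -- a Galois extension with this group has at least as many Hopf Galois structures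
    (∀ (K : Type u) (L : Type v) [Field K] [Field L] [Algebra K L] [FiniteDimensional K L]
      [IsGalois K L], Nonempty ((L ≃ₐ[K] L) ≃* Multiplicative (Fin 4 → ZMod p)) →
      (squareDimOneSubgroups (ZMod p) (Fin 4 → ZMod p)).encard ≤
        ENat.card (HopfGaloisClasses K L) ∧
      (p : ℕ∞) ^ 9 < (squareDimOneSubgroups (ZMod p) (Fin 4 → ZMod p)).encard ∧
      (p : ℕ∞) ^ 9 < ENat.card (HopfGaloisClasses K L)) := by
  have h2 : (2 : ZMod p) ≠ 0 := by
    intro h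
    have h' : ((2 : ℕ) : ZMod p) = 0 := by exact_mod_cast h
    rw [ZMod.natCast_eq_zero_iff] at h'
    exact hp ((Nat.prime_dvd_prime_iff_eq Fact.out Nat.prime_two).1 h')
  -- These give the change of coordinates from `x₀² - x₁² - x₂²` to the sum of three squares.
  obtain ⟨a, b, hab⟩ := ZMod.sq_add_sq p (-1)
  refine ⟨?_, ?_, ?_⟩
  · rintro _ ⟨A, -, -, rfl⟩
    exact ⟨A.isRegularSubgroup, A.regularSubgroup_le_holomorph⟩
  · intro s t hs hs' ht
    obtain ⟨e0, e1, e2, e3, e4, e5, -⟩ :=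
      NilpotentStructure.squareDimOneSubgroups_classification h2 hab hs hs' ht
    rw [Nat.card_zmod] at e2 e3 e4 e5
    exact ⟨e0, e1, e2, e3, e4, e5⟩
  · intro K L _ _ _ _ _ ⟨e⟩
    have hle := encard_squareDimOneSubgroups_le (F := ZMod p) e
    have hlt : (p : ℕ∞) ^ 9 < (squareDimOneSubgroups (ZMod p) (Fin 4 → ZMod p)).encard := by
      obtain ⟨t, ht⟩ := FiniteField.exists_nonsquare (F := ZMod p)
        (by rwa [ZMod.ringChar_zmod_n])
      obtain ⟨-, -, -, -, -, -, e6⟩ :=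
        -- Any admissible pair serves to obtain the total: `-s = 1` is a square, and `-(-t) = t` is
        -- the chosen non-square.
        NilpotentStructure.squareDimOneSubgroups_classification (s := -1) (t := -t) h2 hab
          (neg_ne_zero.2 one_ne_zero) (by simp) (by rwa [neg_neg])
      have h1 : (2 : ℚ) ≤ p := by exact_mod_cast (Fact.out : p.Prime).two_le
      have h9 : (p : ℚ) ^ 9 < (squareDimOneSubgroups (ZMod p) (Fin 4 → ZMod p)).ncard := by
        rw [e6, Nat.card_zmod]
        -- Expanding `(p³+p²+p+1)(p⁶-1)` leaves `p⁹` plus the difference of these two sides.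
        have h3 : (p : ℚ) ^ 3 + p ^ 2 + p + 1 < p ^ 6 * (p ^ 2 + p + 1) := by
          have h8 : (2 : ℚ) ^ 3 ≤ p ^ 3 := pow_le_pow_left₀ zero_le_two h1 3
          have h63 : (p : ℚ) ^ 3 < p ^ 6 - 1 := by nlinarith
          nlinarith [sq_nonneg (p : ℚ)]
        linear_combination h3
      rw [← (Set.toFinite _ : (squareDimOneSubgroups (ZMod p)
        (Fin 4 → ZMod p)).Finite).cast_ncard_eq]
      exact_mod_cast h9
    exact ⟨hle, hlt, hlt.trans_le hle⟩
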